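/- Let $A$ be a unital commutative associative $\mathbb{C}$-algebra with identity $e$, and let $B$ be a vertex $A$-algebroid: a complex vector space with a bilinear map $A\times B\to B$, $(a,v)\mapsto a*v$, with $e*v=v$; a (left) Leibniz bracket $[\cdot,\cdot]$ on $B$; a homomorphism of Leibniz algebras $\pi:B\to\mathrm{Der}(A)$; a symmetric bilinear pairing $\langle\cdot,\cdot\rangle:B\times B\to A$; and a linear map $\partial:A\to B$ with $\pi\circ\partial=0$, such that for $a,a'\in A$, $u,v,v_1,v_2\in B$ $$a*(a'*v)-(aa')*v=\pi(v)(a)*\partial a'+\pi(v)(a')*\partial a,\quad [u,a*v]=\pi(u)(a)*v+a*[u,v],\quad [u,v]+[v,u]=\partial\langle u,v\rangle,$$ $$\pi(a*v)=a\,\pi(v),\quad \langle a*u,v\rangle=a\langle u,v\rangle-\pi(u)(\pi(v)(a)),\quad \pi(v)\langle v_1,v_2\rangle=\langle[v,v_1],v_2\rangle+\langle v_1,[v,v_2]\rangle,$$ $$\partial(aa')=a*\partial a'+a'*\partial a,\quad [v,\partial a]=\partial(\pi(v)(a)),\quad \langle v,\partial a\rangle=\pi(v)(a).$$ Let $\mathcal{L}$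 be the quotient of $(A\oplus B)\otimes\mathbb{C}[t,t^{-1}]$ by the subspace spanned by the elements $\partial a\otimes t^n+n\,a\otimes t^{n-1}$ $(a\in A,\ n\in\mathbb{Z})$. Writing $u(n)$ for the class of $u\otimes t^n$, it is a Lie algebra with $[u(m),v(n)]=(u_0v)(m+n)+m\,(u_1v)(m+n-1)$, where for $a,a'\in A$, $b,b'\in B$ one sets $b_0a=\pi(b)(a)=-a_0b$, $b_0b'=[b,b']$, $b_1b'=\langle b,b'\rangle$, and all other products are zero. Let $\mathcal{L}^{\ge0}$ be the span of the $u(n)$ with $n\ge0$, and let $V_{\mathcal{L}}=U(\mathcal{L})\otimes_{U(\mathcal{L}^{\ge0})}\mathbb{C}$ be the associated vertex algebra, with vacuum $\mathbf{1}=1\otimes1$ and $Y(u(-1)\mathbf{1},x)=\sum_n u(n)x^{-n-1}$ for $u\in A\oplus B$, graded by $\deg\mathbf{1}=0$, $\deg a(n)=-n-1$, $\deg b(n)=-n$ $(a\in A,\ b\in B)$. Identify $u\in A\oplus B$ with $u(-1)\mathbf{1}$. Let $\mathcal{D}$ be the operator $v\mapsto v_{-2}\mathbf{1}$ and let $V_B=V_{\mathcal{L}}/I_B$,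 where $I_B=U(\mathcal{L})\,\mathbb{C}[\mathcal{D}]\,E$ and $E$ is the span of the vectors $e-\mathbf{1}$, $a(-1)a'-aa'$, $a(-1)b-a*b$ $(a,a'\in A,\ b\in B)$, with the induced grading $V_B=\coprod_k (V_B)_{(k)}$. Let $A\partial A\subset B$ be the span of the elements $a*\partial a'$. Then $B/A\partial A$ is a Lie $A$-algebroid (Lie–Rinehart algebra) with the bracket and the $A$-action induced by $[\cdot,\cdot]$ and $*$, acting on $A$ through $\pi$. A module for a Lie $A$-algebroid $\mathfrak g$ is a vector space that is both an $A$-module and a $\mathfrak g$-module, with $u(aw)-a(uw)=(ua)w$ and $a(uw)=(au)w$ for $a\in A$, $u\in\mathfrak g$; it is simple if it is nonzero and has no subspaces stable under $A$ and $\mathfrak g$ other than $0$ and itself. Let $W=\coprod_{n\in\mathbb{N}}W(n)$ be an $\mathbb{N}$-graded $V_B$-module, i.e. a $V_B$-module with $v_mW(n)\subset W(k+n-m-1)$ for $v\in(V_B)_{(k)}$, $m\in\mathbb{Z}$, $n\in\mathbb{N}$ (where $W(j)=0$ for $j<0$), and suppose $W(0)\neq0$. Then $W(0)$ is an $A$-module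 with $aw=a_{-1}w$ $(a\in A,\ w\in W(0))$ and a module for the Lie algebra $B/A\partial A$ with $(b+A\partial A)w=b_0w$ $(b\in B,\ w\in W(0))$, and with these two structures $W(0)$ is a module for the Lie $A$-algebroid $B/A\partial A$. If moreover $W$ is graded simple (that is, nonzero and without graded $V_B$-submodules other than $0$ and $W$), then $W(0)$ is a simple module for the Lie $A$-algebroid $B/A\partial A$. -/

import Mathlib

noncomputable section

/-- The Jacobi identity for the pair `u, v` of states, written in coefficients: comparing the
coefficients of `x₀^{-l-1} x₁^{-m-1} x₂^{-n-1}` on both sides of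
`x₀⁻¹ δ((x₁ - x₂)/x₀) Y(u,x₁) Y(v,x₂) w - x₀⁻¹ δ((x₂ - x₁)/(-x₀)) Y(v,x₂) Y(u,x₁) w
  = x₂⁻¹ δ((x₁ - x₀)/x₂) Y(Y(u,x₀)v, x₂) w`.
Here `YV u n v` is the vector `u_n v` of `V` and `YW u n` is the operator `u_n` on `W`.
By the truncation condition all the sums have only finitely many nonzero terms. -/
def JacobiIdentity {V W : Type*} [AddCommGroup V] [Module ℂ V] [AddCommGroup W] [Module ℂ W]
    (YV : V →ₗ[ℂ] (ℤ → Module.End ℂ V)) (YW : V →ₗ[ℂ] (ℤ → Module.End ℂ W)) : Prop :=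
  ∀ (u v : V) (w : W) (l m n : ℤ),
    ∑ᶠ i : ℕ, ((-1) ^ i * Ring.choose l i) •
        (YW u (m + l - i) (YW v (n + i) w) -
          (l.negOnePow : ℤ) • YW v (n + l - i) (YW u (m + i) w)) =
      ∑ᶠ i : ℕ, Ring.choose m i • YW (YV u (l + i) v) (m + n - i) w

/-- A vertex algebra structure on the complex vector space `V`: a linear map
`Y : V → (End V)[[x, x⁻¹]]`, `Y(v,x) = ∑ v_n x^{-n-1}`, `v_n = Y v n`, and a vacuum vector. -/
class VertexAlgebra (V : Type*) [AddCommGroup V] [Module ℂ V] where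
  vac : V
  Y : V →ₗ[ℂ] (ℤ → Module.End ℂ V)
  trunc : ∀ u v : V, ∃ N : ℤ, ∀ n : ℤ, N ≤ n → Y u n v = 0
  vac_left : ∀ (n : ℤ) (v : V), Y vac n v = if n = -1 then v else 0
  vac_right : ∀ (v : V) (n : ℤ), 0 ≤ n → Y v n vac = 0
  creation : ∀ v : V, Y v (-1) vac = v
  jacobi : JacobiIdentity Y Y

/-- A module structure on `W` for the vertex algebra `V`; `Y v n` is the operator `v_n` on `W`. -/
class VertexModule (V : Type*) [AddCommGroup V] [Module ℂ V] [VertexAlgebra V]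
    (W : Type*) [AddCommGroup W] [Module ℂ W] where
  Y : V →ₗ[ℂ] (ℤ → Module.End ℂ W)
  trunc : ∀ (v : V) (w : W), ∃ N : ℤ, ∀ n : ℤ, N ≤ n → Y v n w = 0
  vac_left : ∀ (n : ℤ) (w : W), Y VertexAlgebra.vac n w = if n = -1 then w else 0
  jacobi : JacobiIdentity VertexAlgebra.Y Y


/-- The binomially weighted sum `∑_{i ≥ 0} (p choose i) f i` of a sequence that vanishes eventually. -/
def bsum {V : Type*} [AddCommGroup V] (p : ℤ) (f : ℕ → V) : V :=
  ∑ᶠ i : ℕ, Ring.choose p i • f i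

section BSum

variable {V : Type*} [AddCommGroup V]

theorem finsum_eq_range {f : ℕ → V} (N : ℕ) (h : ∀ i, N ≤ i → f i = 0) :
    ∑ᶠ i, f i = ∑ i ∈ Finset.range N, f i := by
  apply finsum_eq_sum_of_support_subset
  intro i hi
  simp only [Finset.coe_range, Set.mem_Iio]
  by_contra hc
  exact hi (h i (not_lt.mp hc))

theorem bsum_eq_range (p : ℤ) {f : ℕ → V} (N : ℕ) (h : ∀ i, N ≤ i → f i = 0) :
    bsum p f = ∑ i ∈ Finset.range N, Ring.choose p i • f i :=
  finsum_eq_range N fun i hi => by rw [h i hi, smul_zero]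

theorem bsum_zero (p : ℤ) : bsum p (fun _ => (0 : V)) = 0 := by simp [bsum]

theorem bsum_map {W : Type*} [AddCommGroup W] (L : V →+ W) (p : ℤ) {f : ℕ → V} (N : ℕ)
    (h : ∀ i, N ≤ i → f i = 0) : L (bsum p f) = bsum p fun i => L (f i) := by
  rw [bsum_eq_range p N h, bsum_eq_range p N (fun i hi => by rw [h i hi, map_zero]), map_sum]
  exact Finset.sum_congr rfl fun i _ => map_zsmul _ _ _

theorem bsum_add (p : ℤ) {f g : ℕ → V} (N : ℕ)
    (hf : ∀ i, N ≤ i → f i = 0) (hg : ∀ i, N ≤ i → g i = 0) :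
    bsum p (fun i => f i + g i) = bsum p f + bsum p g := by
  rw [bsum_eq_range p N hf, bsum_eq_range p N hg,
    bsum_eq_range p N (fun i hi => by rw [hf i hi, hg i hi, add_zero]), ← Finset.sum_add_distrib]
  exact Finset.sum_congr rfl fun i _ => smul_add _ _ _

theorem bsum_sub (p : ℤ) {f g : ℕ → V} (N : ℕ)
    (hf : ∀ i, N ≤ i → f i = 0) (hg : ∀ i, N ≤ i → g i = 0) :
    bsum p (fun i => f i - g i) = bsum p f - bsum p g := by
  rw [bsum_eq_range p N hf, bsum_eq_range p N hg,
    bsum_eq_range p N (fun i hi => by rw [hf i hi, hg i hi, sub_zero]), ← Finset.sum_sub_distrib]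
  exact Finset.sum_congr rfl fun i _ => smul_sub _ _ _

theorem bsum_succ (p : ℤ) {f : ℕ → V} (N : ℕ) (h : ∀ i, N ≤ i → f i = 0) :
    bsum (p + 1) f = bsum p f + bsum p fun i => f (i + 1) := by
  rw [bsum_eq_range (p + 1) (N + 1) (fun i hi => h i (by omega)),
    bsum_eq_range p (N + 1) (fun i hi => h i (by omega)),
    bsum_eq_range p N (fun i hi => h (i + 1) (by omega)),
    Finset.sum_range_succ' _ N, Finset.sum_range_succ' _ N]
  simp only [Ring.choose_succ_succ, add_smul, Finset.sum_add_distrib, Ring.choose_zero_right]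
  abel

theorem bsum_weight (p : ℤ) {f : ℕ → V} (N : ℕ) (h : ∀ i, N ≤ i → f i = 0) :
    bsum p (fun i => (i : ℤ) • f i) = p • bsum (p - 1) fun i => f (i + 1) := by
  rw [bsum_eq_range p (N + 1) (fun i hi => by rw [h i (by omega), smul_zero]),
    bsum_eq_range (p - 1) N (fun i hi => h (i + 1) (by omega)),
    Finset.sum_range_succ' _ N, Finset.smul_sum]
  simp only [Nat.cast_zero, zero_smul, smul_zero, add_zero]
  refine Finset.sum_congr rfl fun i _ => ?_
  rw [smul_smul, smul_smul]
  congr 1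
  have h2 := Ring.choose_smul_choose (p : ℤ) (n := i + 1) (k := 1) (by omega)
  simpa [Ring.choose_one_right, mul_comm] using h2

theorem bsum_comm (p q : ℤ) {f : ℕ → ℕ → V} (N : ℕ)
    (h1 : ∀ i j, N ≤ i → f i j = 0) (h2 : ∀ i j, N ≤ j → f i j = 0) :
    (bsum p fun i => bsum q fun j => f i j) = bsum q fun j => bsum p fun i => f i j := by
  rw [bsum_eq_range p N fun i hi => by simp only [h1 i _ hi, bsum_zero],
    bsum_eq_range q N fun j hj => by simp only [h2 _ j hj, bsum_zero]]
  simp_rw [bsum_eq_range q N (h2 _), bsum_eq_range p N (fun i => h1 i _), Finset.smul_sum]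
  rw [Finset.sum_comm]
  exact Finset.sum_congr rfl fun i _ => Finset.sum_congr rfl fun j _ => smul_comm _ _ _

theorem bsum_diag (p q : ℤ) {h : ℕ → V} (N : ℕ) (hN : ∀ i, N ≤ i → h i = 0) :
    (bsum p fun i => bsum q fun j => h (i + j)) = bsum (p + q) h := by
  rw [bsum_eq_range (p + q) N hN, bsum_eq_range p N fun i hi => by
    simp only [hN _ (Nat.le_add_right_of_le hi), bsum_zero]]
  have e : ∀ i ∈ Finset.range N, Ring.choose p i • bsum q (fun j => h (i + j)) =
      ∑ j ∈ Finset.range (N - i), (Ring.choose p i * Ring.choose q j) • h (i + j) := by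
    intro i _
    rw [bsum_eq_range q (N - i) fun j hj => hN _ (by omega), Finset.smul_sum]
    exact Finset.sum_congr rfl fun j _ => smul_smul _ _ _
  rw [Finset.sum_congr rfl e, ← Finset.sum_range_diag_flip N fun i j =>
    (Ring.choose p i * Ring.choose q j) • h (i + j)]
  refine Finset.sum_congr rfl fun r _ => ?_
  rw [Ring.add_choose_eq r (Commute.all p q), Finset.sum_smul,
    Finset.Nat.sum_antidiagonal_eq_sum_range_succ fun i j => (Ring.choose p i * Ring.choose q j) • h r]
  refine Finset.sum_congr rfl fun i hi => ?_
  rw [Nat.add_sub_cancel' (by simpa [Nat.lt_succ_iff] using hi)]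

theorem bsum_trinom (p : ℤ) {f : ℕ → ℕ → V} (N : ℕ)
    (h1 : ∀ s j, N ≤ s → f s j = 0) (h2 : ∀ s j, N ≤ j → f s j = 0) :
    (bsum p fun j => bsum (j : ℤ) fun s => f s j) =
      bsum p fun s => bsum (p - s) fun j => f s (s + j) := by
  rw [bsum_eq_range p N fun j hj => by simp only [h2 _ j hj, bsum_zero],
    bsum_eq_range p N fun s hs => by simp only [h1 s _ hs, bsum_zero]]
  have e : ∀ s ∈ Finset.range N, Ring.choose p s • bsum (p - s) (fun j => f s (s + j)) =
      ∑ j ∈ Finset.range (N - s),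
        (Ring.choose p (s + j) * ((s + j).choose s : ℤ)) • f s (s + j) := by
    intro s _
    rw [bsum_eq_range _ (N - s) fun j hj => h2 _ _ (by omega), Finset.smul_sum]
    refine Finset.sum_congr rfl fun j _ => ?_
    rw [smul_smul]
    congr 1
    have := Ring.choose_smul_choose (p : ℤ) (n := s + j) (k := s) (by omega)
    simp only [nsmul_eq_mul, Nat.add_sub_cancel_left] at this
    rw [← this, mul_comm]
  rw [Finset.sum_congr rfl e, ← Finset.sum_range_diag_flip N fun s j =>
    (Ring.choose p (s + j) * ((s + j).choose s : ℤ)) • f s (s + j)]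
  refine Finset.sum_congr rfl fun j _ => ?_
  have e2 : bsum (j : ℤ) (fun s => f s j) =
      ∑ s ∈ Finset.range (j + 1), Ring.choose (j : ℤ) s • f s j := by
    unfold bsum
    apply finsum_eq_range
    intro s hs
    rw [Ring.choose_natCast, Nat.choose_eq_zero_of_lt hs]
    simp
  rw [e2, Finset.smul_sum]
  refine Finset.sum_congr rfl fun s hs => ?_
  rw [smul_smul, Ring.choose_natCast, Nat.add_sub_cancel' (by simpa [Nat.lt_succ_iff] using hs)]

theorem bsum_weight' (p : ℤ) {f : ℕ → V} (N : ℕ) (h : ∀ i, N ≤ i → f i = 0) :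
    bsum p (fun i => (p - i) • f i) = p • bsum (p - 1) f := by
  have h1 := bsum_weight p N h
  have h2 := bsum_succ (p - 1) N h
  rw [sub_add_cancel] at h2
  have h3 : (bsum p fun i => (p - i) • f i) = p • bsum p f - bsum p fun i => (i : ℤ) • f i := by
    have h4 := bsum_map (DistribSMul.toAddMonoidHom V p) p N h
    simp only [DistribSMul.toAddMonoidHom_apply] at h4
    rw [h4, ← bsum_sub p N (fun i hi => by rw [h i hi, smul_zero])
      (fun i hi => by rw [h i hi, smul_zero])]
    simp only [sub_smul]
  rw [h3, h1, h2, smul_add]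
  abel

theorem bsum_natCast (P : ℕ) (f : ℕ → V) :
    bsum (P : ℤ) f = ∑ i ∈ Finset.range (P + 1), (P.choose i : ℤ) • f i := by
  unfold bsum
  rw [finsum_eq_range (P + 1) fun s hs => by
    rw [Ring.choose_natCast, Nat.choose_eq_zero_of_lt hs]; simp]
  simp only [Ring.choose_natCast]

theorem bsum_zero_left (f : ℕ → V) : bsum 0 f = f 0 := by
  have := bsum_natCast 0 f
  simpa using this

theorem bsum_natCast_reflect (P : ℕ) (f : ℕ → V) :
    bsum (P : ℤ) f = bsum (P : ℤ) fun i => f (P - i) := by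
  rw [bsum_natCast, bsum_natCast, ← Finset.sum_range_reflect]
  refine Finset.sum_congr rfl fun i hi => ?_
  have : i ≤ P := by simpa [Nat.lt_succ_iff] using hi
  rw [show P + 1 - 1 - i = P - i by omega, Nat.choose_symm this]

theorem bsum_congr_nat (P : ℕ) {f h : ℕ → V} (hfh : ∀ i, i ≤ P → f i = h i) :
    bsum (P : ℤ) f = bsum (P : ℤ) h := by
  rw [bsum_natCast, bsum_natCast]
  refine Finset.sum_congr rfl fun i hi => ?_
  rw [hfh i (by simpa [Nat.lt_succ_iff] using hi)]

theorem bsum_smul (p c : ℤ) {f : ℕ → V} (N : ℕ) (h : ∀ i, N ≤ i → f i = 0) :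
    c • bsum p f = bsum p fun i => c • f i := by
  have h4 := bsum_map (DistribSMul.toAddMonoidHom V c) p N h
  simpa only [DistribSMul.toAddMonoidHom_apply] using h4

theorem choose_neg_one (i : ℕ) : Ring.choose (-1 : ℤ) i = (-1) ^ i := by
  have h := Ring.choose_neg (1 : ℤ) i
  rw [h, Int.negOnePow_def]
  simp [Units.smul_def, Ring.choose_natCast]

theorem bsum_neg_one_shift {f : ℕ → V} (k N : ℕ) (h : ∀ i, N ≤ i → f i = 0)
    (hk : ∀ i, i < k → f i = 0) :
    bsum (-1) f = (-1 : ℤ) ^ k • bsum (-1) fun i => f (k + i) := by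
  rw [bsum_eq_range _ (k + N) (fun i hi => h i (by omega)),
    bsum_eq_range _ N (fun i hi => h _ (by omega)), Finset.sum_range_add,
    Finset.sum_eq_zero (fun i hi => by rw [hk i (by simpa using hi), smul_zero]), zero_add,
    Finset.smul_sum]
  refine Finset.sum_congr rfl fun i _ => ?_
  rw [choose_neg_one, choose_neg_one, smul_smul, pow_add]

end BSum


/-- Operators `g u n` (`u : C`, `n : ℤ`) on `V` generating `V` from a vacuum vector, with the
commutation relations of a `1`-truncated conformal algebra `C` and a translation operator `D`. -/
structure GenSys (C V : Type*) [AddCommGroup V] [Module ℂ V] where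
  op0 : C → C → C
  op1 : C → C → C
  g : C → ℤ → Module.End ℂ V
  vac : V
  D : Module.End ℂ V
  comm : ∀ u v m n x, g u m (g v n x) - g v n (g u m x) =
    g (op0 u v) (m + n) x + m • g (op1 u v) (m + n - 1) x
  trunc : ∀ u x, ∃ N : ℕ, ∀ n : ℤ, N ≤ n → g u n x = 0
  g_vac : ∀ u n, 0 ≤ n → g u n vac = 0
  D_g : ∀ u n x, D (g u n x) - g u n (D x) = -(n • g u (n - 1) x)
  D_vac : D vac = 0
  ind : ∀ S : Submodule ℂ V, vac ∈ S → (∀ u n x, x ∈ S → g u n x ∈ S) → ∀ x, x ∈ S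

namespace GenSys

variable {C V : Type*} [AddCommGroup V] [Module ℂ V] (S : GenSys C V)

/-- Right part of the action of `g u p` on linear maps `V → V[[z, z⁻¹]]`. -/
def R (u : C) (p : ℤ) : (V →ₗ[ℂ] (ℤ → V)) →ₗ[ℂ] (V →ₗ[ℂ] (ℤ → V)) where
  toFun φ :=
    { toFun := fun v n => bsum p fun j => φ (S.g u j v) (p + n - j)
      map_add' := fun v w => by
        funext n
        obtain ⟨N, hN⟩ := S.trunc u v
        obtain ⟨N', hN'⟩ := S.trunc u w
        simp only [map_add, Pi.add_apply]
        exact bsum_add p (max N N')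
          (fun i hi => by rw [hN i (by omega)]; simp) (fun i hi => by rw [hN' i (by omega)]; simp)
      map_smul' := fun c v => by
        funext n
        obtain ⟨N, hN⟩ := S.trunc u v
        simp only [map_smul, Pi.smul_apply, RingHom.id_apply]
        exact (bsum_map (DistribSMul.toAddMonoidHom V c) p N
          (fun i hi => by rw [hN i (by omega)]; simp)).symm }
  map_add' φ ψ := by
    ext v n
    obtain ⟨N, hN⟩ := S.trunc u v
    simp only [LinearMap.add_apply, Pi.add_apply, LinearMap.coe_mk, AddHom.coe_mk]
    exact bsum_add p N
      (fun i hi => by rw [hN i (by omega)]; simp) (fun i hi => by rw [hN i (by omega)]; simp)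
  map_smul' c φ := by
    ext v n
    obtain ⟨N, hN⟩ := S.trunc u v
    simp only [LinearMap.smul_apply, Pi.smul_apply, LinearMap.coe_mk, AddHom.coe_mk,
      RingHom.id_apply]
    exact (bsum_map (DistribSMul.toAddMonoidHom V c) p N
      (fun i hi => by rw [hN i (by omega)]; simp)).symm

theorem R_apply (u : C) (p : ℤ) (φ : V →ₗ[ℂ] (ℤ → V)) (v : V) (n : ℤ) :
    S.R u p φ v n = bsum p fun j => φ (S.g u j v) (p + n - j) := rfl

/-- Left part of the action of `g u p` on linear maps `V → V[[z, z⁻¹]]`. -/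
def Lft (u : C) (p : ℤ) : (V →ₗ[ℂ] (ℤ → V)) →ₗ[ℂ] (V →ₗ[ℂ] (ℤ → V)) where
  toFun φ := (LinearMap.pi fun n => S.g u p ∘ₗ LinearMap.proj n) ∘ₗ φ
  map_add' φ ψ := by ext; simp
  map_smul' c φ := by ext; simp

theorem Lft_apply (u : C) (p : ℤ) (φ : V →ₗ[ℂ] (ℤ → V)) (v : V) (n : ℤ) :
    S.Lft u p φ v n = S.g u p (φ v n) := rfl

/-- The action of `g u p` on linear maps `V → V[[z, z⁻¹]]`. -/
def G (u : C) (p : ℤ) : Module.End ℂ (V →ₗ[ℂ] (ℤ → V)) := S.Lft u p - S.R u p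

theorem G_apply (u : C) (p : ℤ) (φ : V →ₗ[ℂ] (ℤ → V)) (v : V) (n : ℤ) :
    S.G u p φ v n = S.g u p (φ v n) - bsum p fun j => φ (S.g u j v) (p + n - j) := rfl

theorem R_Lft (u v : C) (p q : ℤ) (φ : V →ₗ[ℂ] (ℤ → V)) :
    S.R u p (S.Lft v q φ) = S.Lft v q (S.R u p φ) := by
  ext x n
  obtain ⟨N, hN⟩ := S.trunc u x
  simp only [R_apply, Lft_apply]
  exact (bsum_map (S.g v q).toAddMonoidHom p N
    (fun i hi => by rw [hN i (by omega)]; simp)).symm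

/-- A common bound for the vanishing of `g u i` on the vectors `g v j x`, `j ≥ 0`. -/
theorem trunc₂ (u v : C) (x : V) : ∃ N : ℕ, (∀ i j : ℕ, N ≤ i → S.g u i (S.g v j x) = 0) ∧
    (∀ i j : ℕ, N ≤ j → S.g u i (S.g v j x) = 0) := by
  obtain ⟨N, hN⟩ := S.trunc v x
  choose M hM using fun j : ℕ => S.trunc u (S.g v j x)
  refine ⟨N + ∑ j ∈ Finset.range N, M j, fun i j hi => ?_, fun i j hj => ?_⟩
  · by_cases hj : j < N
    · have := Finset.single_le_sum (f := M) (fun _ _ => Nat.zero_le _) (Finset.mem_range.mpr hj)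
      exact hM j i (by omega)
    · rw [hN j (by omega), map_zero]
  · rw [hN j (by omega), map_zero]

theorem R_comm (u v : C) (p q : ℤ) (φ : V →ₗ[ℂ] (ℤ → V)) :
    S.R v q (S.R u p φ) - S.R u p (S.R v q φ) =
      S.R (S.op0 u v) (p + q) φ + p • S.R (S.op1 u v) (p + q - 1) φ := by
  ext x n
  obtain ⟨N, h1, h2⟩ := S.trunc₂ u v x
  obtain ⟨N', h1', h2'⟩ := S.trunc₂ v u x
  obtain ⟨N0, h0⟩ := S.trunc (S.op0 u v) x
  obtain ⟨N1, h1''⟩ := S.trunc (S.op1 u v) x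
  simp only [LinearMap.sub_apply, LinearMap.add_apply, LinearMap.smul_apply, Pi.sub_apply,
    Pi.add_apply, Pi.smul_apply, R_apply]
  set K := N + N' with hK
  rw [bsum_comm q p K (f := fun j i => φ (S.g u i (S.g v j x)) (p + (q + n - j) - i))
    (fun j i hj => by rw [h2 i j (by omega)]; simp)
    (fun j i hi => by rw [h1 i j (by omega)]; simp)]
  rw [← bsum_sub p K
    (fun i hi => by
      simp only [h1 i _ (show N ≤ i by omega), map_zero, Pi.zero_apply, bsum_zero])
    (fun i hi => by
      simp only [h2' _ i (show N' ≤ i by omega), map_zero, Pi.zero_apply, bsum_zero])]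
  have key : ∀ i : ℕ, ((bsum q fun j => φ (S.g u i (S.g v j x)) (p + (q + n - j) - i)) -
      bsum q fun j => φ (S.g v j (S.g u i x)) (q + (p + n - i) - j)) =
      (bsum q fun j => φ (S.g (S.op0 u v) ((i + j : ℕ) : ℤ) x) (p + q + n - ((i + j : ℕ) : ℤ))) +
      (i : ℤ) • bsum q fun j =>
        φ (S.g (S.op1 u v) (((i + j : ℕ) : ℤ) - 1) x) (p + q + n - ((i + j : ℕ) : ℤ)) := by
    intro i
    rw [← bsum_sub q K (fun j hj => by rw [h2 i j (by omega)]; simp)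
      (fun j hj => by rw [h1' j i (by omega)]; simp)]
    have hm := bsum_map (DistribSMul.toAddMonoidHom V (i : ℤ)) q (N1 + 1)
      (f := fun j => φ (S.g (S.op1 u v) (((i + j : ℕ) : ℤ) - 1) x) (p + q + n - ((i + j : ℕ) : ℤ)))
      (fun j hj => by rw [h1'' _ (by push_cast; omega)]; simp)
    simp only [DistribSMul.toAddMonoidHom_apply] at hm
    rw [hm, ← bsum_add q (N0 + N1 + 1) (fun j hj => by rw [h0 _ (by push_cast; omega)]; simp)
      (fun j hj => by rw [h1'' _ (by push_cast; omega)]; simp)]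
    congr 1
    funext j
    have hc := S.comm u v i j x
    rw [show p + (q + n - j) - (i : ℤ) = p + q + n - ((i + j : ℕ) : ℤ) by push_cast; ring,
      show q + (p + n - i) - (j : ℤ) = p + q + n - ((i + j : ℕ) : ℤ) by push_cast; ring,
      ← Pi.sub_apply, ← map_sub, hc, map_add, map_zsmul]
    push_cast
    rfl
  simp_rw [key]
  rw [bsum_add p (N0 + N1 + 1)
    (fun i hi => by
      have : ∀ j : ℕ, S.g (S.op0 u v) ((i + j : ℕ) : ℤ) x = 0 :=
        fun j => h0 _ (by push_cast; omega)
      simp only [this, map_zero, Pi.zero_apply, bsum_zero])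
    (fun i hi => by
      have : ∀ j : ℕ, S.g (S.op1 u v) (((i + j : ℕ) : ℤ) - 1) x = 0 :=
        fun j => h1'' _ (by push_cast; omega)
      simp only [this, map_zero, Pi.zero_apply, bsum_zero, smul_zero])]
  congr 1
  · exact bsum_diag p q (h := fun r : ℕ => φ (S.g (S.op0 u v) r x) (p + q + n - r)) N0
      (fun i hi => by rw [h0 _ (by omega)]; simp)
  · rw [bsum_weight p (N1 + 1) (fun i hi => by
      have : ∀ j : ℕ, S.g (S.op1 u v) (((i + j : ℕ) : ℤ) - 1) x = 0 :=
        fun j => h1'' _ (by push_cast; omega)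
      simp only [this, map_zero, Pi.zero_apply, bsum_zero])]
    congr 1
    have := bsum_diag (p - 1) q
      (h := fun r : ℕ => φ (S.g (S.op1 u v) r x) (p + q - 1 + n - r)) N1
      (fun i hi => by rw [h1'' _ (by omega)]; simp)
    rw [show p + q - 1 = p - 1 + q by ring] at this ⊢
    rw [← this]
    congr 1; funext i; congr 1; funext j
    push_cast
    rw [show (i : ℤ) + 1 + j - 1 = i + j by ring,
      show p + q + n - ((i : ℤ) + 1 + j) = p - 1 + q + n - (i + j) by ring]

theorem G_comm (u v : C) (p q : ℤ) (φ : V →ₗ[ℂ] (ℤ → V)) :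
    S.G u p (S.G v q φ) - S.G v q (S.G u p φ) =
      S.G (S.op0 u v) (p + q) φ + p • S.G (S.op1 u v) (p + q - 1) φ := by
  have hR := S.R_comm u v p q φ
  have hL : S.Lft u p (S.Lft v q φ) - S.Lft v q (S.Lft u p φ) =
      S.Lft (S.op0 u v) (p + q) φ + p • S.Lft (S.op1 u v) (p + q - 1) φ := by
    ext x n
    simp only [LinearMap.sub_apply, LinearMap.add_apply, LinearMap.smul_apply, Pi.sub_apply,
      Pi.add_apply, Pi.smul_apply, Lft_apply]
    exact S.comm u v p q _
  simp only [G, LinearMap.sub_apply, map_sub, R_Lft]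
  rw [smul_sub]
  linear_combination (norm := module) hL - hR

/-- The divided power `D ^ k / k!`, extended by zero to negative `k`. -/
def E (k : ℤ) : Module.End ℂ V :=
  if 0 ≤ k then ((k.toNat.factorial : ℂ)⁻¹) • S.D ^ k.toNat else 0

theorem E_neg {k : ℤ} (h : k < 0) : S.E k = 0 := by simp [E, not_le.mpr h]

theorem E_zero : S.E 0 = 1 := by simp [E]

theorem D_E (k : ℤ) (x : V) : S.D (S.E k x) = (k + 1) • S.E (k + 1) x := by
  rcases lt_trichotomy k (-1) with h | h | h
  · rw [E_neg _ (by omega), E_neg _ (by omega)]; simp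
  · subst h; rw [E_neg _ (by omega)]; simp
  · obtain ⟨n, rfl⟩ := Int.eq_ofNat_of_zero_le (show 0 ≤ k by omega)
    have h1 : (0 : ℤ) ≤ (n : ℤ) + 1 := by omega
    simp only [E, Int.natCast_nonneg, h1, if_true, Int.toNat_natCast,
      show ((n : ℤ) + 1).toNat = n + 1 by omega, LinearMap.smul_apply, map_smul]
    rw [pow_succ', Module.End.mul_apply, ← Int.cast_smul_eq_zsmul ℂ, smul_smul]
    congr 1
    rw [Nat.factorial_succ]
    have : ((n : ℂ) + 1) ≠ 0 := by exact_mod_cast Nat.succ_ne_zero n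
    push_cast
    field_simp

theorem E_vac (k : ℤ) : S.E k S.vac = if k = 0 then S.vac else 0 := by
  rcases lt_trichotomy k 0 with h | h | h
  · rw [E_neg _ h, if_neg h.ne]; rfl
  · subst h; simp [E_zero]
  · obtain ⟨n, rfl⟩ := Int.eq_ofNat_of_zero_le h.le
    obtain ⟨m, rfl⟩ := Nat.exists_eq_succ_of_ne_zero (n := n) (by omega)
    simp only [E]
    rw [if_neg h.ne', if_pos h.le, LinearMap.smul_apply, Int.toNat_natCast, Nat.succ_eq_add_one,
      pow_succ, Module.End.mul_apply, S.D_vac, map_zero, smul_zero]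

theorem zsmul_cancel {n : ℤ} (hn : n ≠ 0) {x y : V} (h : n • x = n • y) : x = y := by
  rw [← Int.cast_smul_eq_zsmul ℂ, ← Int.cast_smul_eq_zsmul ℂ] at h
  exact (smul_right_injective V (show (n : ℂ) ≠ 0 by exact_mod_cast hn)) h

theorem E_E (i j : ℕ) (x : V) : S.E i (S.E j x) = ((i + j).choose i : ℤ) • S.E (i + j) x := by
  induction i with
  | zero => simp [E_zero]
  | succ i ih =>
    have h := S.D_E i (S.E j x)
    rw [ih, map_zsmul, D_E] at h
    refine zsmul_cancel (n := (i : ℤ) + 1) (by omega) ?_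
    push_cast
    rw [← h, smul_smul, smul_smul, show (i : ℤ) + 1 + j = i + j + 1 by ring]
    congr 1
    have := Nat.add_one_mul_choose_eq (i + j) i
    rw [show i + 1 + j = i + j + 1 by ring]
    push_cast [← @Nat.cast_inj ℤ] at this
    linarith

/-- The commutation of a translation covariant family of operators with the divided powers. -/
theorem cov_E {f : ℤ → Module.End ℂ V}
    (hf : ∀ n x, S.D (f n x) - f n (S.D x) = -(n • f (n - 1) x)) (k : ℕ) (q : ℤ) (x : V) :
    f q (S.E k x) = bsum q fun t => S.E (k - t) (f (q - t) x) := by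
  induction k generalizing q with
  | zero =>
    rw [bsum_eq_range q 1 fun i hi => by rw [E_neg _ (by push_cast; omega)]; rfl]
    simp [E_zero]
  | succ k ih =>
    refine zsmul_cancel (n := (k : ℤ) + 1) (by omega) ?_
    have h1 := S.D_E k x
    have h2 := hf q (S.E k x)
    have hz : ∀ i : ℕ, k + 1 ≤ i → S.E (k - i) (f (q - i) x) = 0 :=
      fun i hi => by rw [E_neg _ (by omega)]; rfl
    have hz2 : ∀ i : ℕ, k + 2 ≤ i → S.E (k + 1 - i) (f (q - i) x) = 0 :=
      fun i hi => by rw [E_neg _ (by omega)]; rfl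
    push_cast
    rw [← map_zsmul, ← h1, show f q (S.D (S.E k x)) = S.D (f q (S.E k x)) + q • f (q - 1) (S.E k x)
      by rw [sub_eq_iff_eq_add] at h2; rw [h2]; abel, ih, ih]
    have e1 := bsum_map S.D.toAddMonoidHom q (k + 1) hz
    simp only [LinearMap.toAddMonoidHom_coe, D_E] at e1
    have e2 := bsum_weight q (f := fun t : ℕ => S.E (k + 1 - t) (f (q - t) x)) (k + 2) hz2
    have e3 := bsum_map (DistribSMul.toAddMonoidHom V ((k : ℤ) + 1)) q (k + 2) hz2
    simp only [DistribSMul.toAddMonoidHom_apply] at e3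
    rw [e1, e3]
    have e4 : (q • bsum (q - 1) fun t => S.E (k - t) (f (q - 1 - t) x)) =
        bsum q fun i => (i : ℤ) • S.E (k + 1 - i) (f (q - i) x) := by
      rw [e2]
      congr 2
      funext t
      push_cast
      rw [show (k : ℤ) + 1 - (t + 1) = k - t by ring, show q - ((t : ℤ) + 1) = q - 1 - t by ring]
    rw [e4, ← bsum_add q (k + 2)
      (fun i hi => by rw [E_neg _ (by omega)]; simp) (fun i hi => by rw [hz2 i hi, smul_zero])]
    congr 1
    funext t
    rw [show (k : ℤ) - t + 1 = k + 1 - t by ring, ← add_smul]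
    congr 1
    ring

theorem cov_E' {f : ℤ → Module.End ℂ V}
    (hf : ∀ n x, S.D (f n x) - f n (S.D x) = -(n • f (n - 1) x)) (k : ℕ) (q : ℤ) (x : V) :
    S.E k (f q x) = bsum q fun t => (-1 : ℤ) ^ t • f (q - t) (S.E (k - t) x) := by
  induction k generalizing q with
  | zero =>
    rw [bsum_eq_range q 1 fun i hi => by rw [E_neg _ (by push_cast; omega)]; simp]
    simp [E_zero]
  | succ k ih =>
    refine zsmul_cancel (n := (k : ℤ) + 1) (by omega) ?_
    have hz : ∀ i : ℕ, k + 1 ≤ i → (-1 : ℤ) ^ i • f (q - i) (S.E (k - i) x) = 0 :=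
      fun i hi => by rw [E_neg _ (by omega)]; simp
    have hz2 : ∀ i : ℕ, k + 2 ≤ i → (-1 : ℤ) ^ i • f (q - i) (S.E (k + 1 - i) x) = 0 :=
      fun i hi => by rw [E_neg _ (by omega)]; simp
    have hz3 : ∀ i : ℕ, k + 1 ≤ i →
        ((-1 : ℤ) ^ i * (q - i)) • f (q - i - 1) (S.E (k - i) x) = 0 :=
      fun i hi => by rw [E_neg _ (by omega)]; simp
    push_cast
    rw [← S.D_E k, ih]
    have e1 := bsum_map S.D.toAddMonoidHom q (k + 1) hz
    simp only [LinearMap.toAddMonoidHom_coe, map_zsmul] at e1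
    have e3 := bsum_map (DistribSMul.toAddMonoidHom V ((k : ℤ) + 1)) q (k + 2) hz2
    simp only [DistribSMul.toAddMonoidHom_apply] at e3
    rw [e1, e3]
    have e5 : ∀ i : ℕ, (-1 : ℤ) ^ i • S.D (f (q - i) (S.E (k - i) x)) =
        ((-1 : ℤ) ^ i * (k + 1 - i)) • f (q - i) (S.E (k + 1 - i) x) -
        ((-1 : ℤ) ^ i * (q - i)) • f (q - i - 1) (S.E (k - i) x) := by
      intro i
      have h2 := hf (q - i) (S.E (k - i) x)
      rw [D_E, map_zsmul, sub_eq_iff_eq_add] at h2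
      rw [h2, show (k : ℤ) - i + 1 = k + 1 - i by ring, smul_add, smul_smul, smul_neg, smul_smul]
      abel
    simp_rw [e5]
    rw [bsum_sub q (k + 2) (fun i hi => by rw [E_neg _ (by omega)]; simp)
      (fun i hi => hz3 i (by omega))]
    have e6 : (bsum q fun i => ((-1 : ℤ) ^ i * (q - i)) • f (q - i - 1) (S.E (k - i) x)) =
        - bsum q fun i => (i : ℤ) • ((-1 : ℤ) ^ i • f (q - i) (S.E (k + 1 - i) x)) := by
      rw [bsum_weight q (k + 2) hz2, bsum_eq_range q (k + 1) hz3,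
        bsum_eq_range (q - 1) (k + 1) (fun i hi => hz2 (i + 1) (by omega)), Finset.smul_sum,
        ← Finset.sum_neg_distrib]
      refine Finset.sum_congr rfl fun i _ => ?_
      push_cast
      rw [show (k : ℤ) + 1 - (i + 1) = k - i by ring, show q - ((i : ℤ) + 1) = q - i - 1 by ring]
      simp only [smul_smul]
      rw [← neg_smul]
      congr 1
      have hc := Ring.choose_smul_choose (q : ℤ) (n := i + 1) (k := 1) (by omega)
      have hc' := Ring.choose_smul_choose (q : ℤ) (n := i + 1) (k := i) (by omega)
      simp only [Ring.choose_one_right, nsmul_eq_mul, Nat.choose_one_right, Nat.cast_one,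
        Nat.add_sub_cancel, Nat.choose_succ_self_right, Nat.add_sub_cancel_left] at hc hc'
      rw [pow_succ]
      linear_combination (-1 : ℤ) ^ i * (hc - hc')
    rw [e6, sub_neg_eq_add, ← bsum_add q (k + 2)
      (fun i hi => by rw [E_neg _ (by omega)]; simp)
      (fun i hi => by rw [hz2 i hi, smul_zero])]
    congr 1
    funext t
    rw [smul_smul, smul_smul, ← add_smul]
    congr 1
    ring
end GenSys


namespace GenSys

variable {C V : Type*} [AddCommGroup V] [Module ℂ V] (S : GenSys C V)

/-- The map `v ↦ e^{zD} v`. -/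
def phi0 : V →ₗ[ℂ] (ℤ → V) := LinearMap.pi fun n => S.E (-1 - n)

theorem G_phi0 (u : C) (p : ℤ) (hp : 0 ≤ p) : S.G u p S.phi0 = 0 := by
  obtain ⟨P, rfl⟩ := Int.eq_ofNat_of_zero_le hp
  ext v n
  rw [G_apply]
  simp only [phi0, LinearMap.pi_apply, LinearMap.zero_apply, Pi.zero_apply]
  rw [sub_eq_zero]
  rcases lt_or_ge (-1 - n) 0 with h | h
  · rw [E_neg _ h, bsum_natCast]
    simp only [LinearMap.zero_apply, map_zero]
    refine (Finset.sum_eq_zero fun i hi => ?_).symm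
    have : i < P + 1 := by simpa using hi
    rw [E_neg _ (by omega)]
    simp
  · obtain ⟨k, hk⟩ := Int.eq_ofNat_of_zero_le h
    rw [hk, S.cov_E (f := S.g u) (S.D_g u), bsum_natCast_reflect]
    refine bsum_congr_nat P fun i hi => ?_
    rw [Nat.cast_sub hi, show (P : ℤ) - (P - i) = i by ring,
      show -1 - ((P : ℤ) + n - i) = k - (P - i) by omega]

end GenSys

/-- A generating system together with the associated state-field correspondence, `F w v n` being
the vector `v_n w`. -/
structure FieldSys (C V : Type*) [AddCommGroup V] [Module ℂ V] extends GenSys C V where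
  F : V →ₗ[ℂ] V →ₗ[ℂ] (ℤ → V)
  F_vac : F vac = toGenSys.phi0
  F_g : ∀ u p w, F (g u p w) = toGenSys.G u p (F w)

namespace FieldSys

variable {C V : Type*} [AddCommGroup V] [Module ℂ V] (S : FieldSys C V)

/-- The state-field correspondence. -/
def Y : V →ₗ[ℂ] (ℤ → Module.End ℂ V) :=
  LinearMap.pi fun n => (LinearMap.compRight ℂ (LinearMap.proj n) ∘ₗ S.F).flip

theorem Y_apply (v : V) (n : ℤ) (w : V) : S.Y v n w = S.F w v n := rfl

theorem Y_vac (v : V) (n : ℤ) : S.Y v n S.vac = S.E (-1 - n) v := by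
  rw [Y_apply, S.F_vac]; rfl

theorem Y_g (v : V) (n : ℤ) (u : C) (p : ℤ) (w : V) : S.Y v n (S.g u p w) =
    S.g u p (S.Y v n w) - bsum p fun j => S.Y (S.g u j v) (p + n - j) w := by
  rw [Y_apply, S.F_g]; rfl

theorem Y_trunc (v w : V) : ∃ N : ℕ, ∀ n : ℤ, N ≤ n → S.Y v n w = 0 := by
  let T : Submodule ℂ V :=
    { carrier := {w | ∀ v, ∃ N : ℕ, ∀ n : ℤ, N ≤ n → S.Y v n w = 0}
      add_mem' := by
        intro a b ha hb v
        obtain ⟨N, hN⟩ := ha v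
        obtain ⟨M, hM⟩ := hb v
        exact ⟨N + M, fun n hn => by
          rw [map_add, hN n (by push_cast at hn; omega), hM n (by push_cast at hn; omega), add_zero]⟩
      zero_mem' := fun v => ⟨0, fun n _ => map_zero _⟩
      smul_mem' := by
        intro c a ha v
        obtain ⟨N, hN⟩ := ha v
        exact ⟨N, fun n hn => by rw [map_smul, hN n hn, smul_zero]⟩ }
  refine S.ind T ?_ ?_ w v
  · intro v
    exact ⟨0, fun n hn => by rw [Y_vac, S.E_neg (by push_cast at hn; omega)]; rfl⟩
  · intro u p w hw v
    obtain ⟨N, hN⟩ := hw v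
    obtain ⟨L, hL⟩ := S.trunc u v
    choose M hM using fun j : ℕ => hw (S.g u j v)
    refine ⟨N + (∑ j ∈ Finset.range L, M j) + p.natAbs + L, fun n hn => ?_⟩
    push_cast at hn
    have hp1 := abs_nonneg p
    have hp2 := neg_abs_le p
    rw [Y_g, hN n (by have : 0 ≤ ∑ j ∈ Finset.range L, (M j : ℤ) :=
        Finset.sum_nonneg fun _ _ => Int.natCast_nonneg _
                      omega), map_zero, zero_sub, neg_eq_zero,
      bsum_eq_range p L fun i hi => by rw [hL i (by omega)]; simp]
    refine Finset.sum_eq_zero fun j hj => ?_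
    have h1 := Finset.single_le_sum (f := fun j => (M j : ℤ))
      (fun _ _ => Int.natCast_nonneg _) hj
    have h2 : j < L := by simpa using hj
    rw [hM j _ (by omega), smul_zero]

/-- Uniform truncation along the vectors `g u j v`, `j ≥ 0`. -/
theorem Y_trunc_g (u : C) (v w : V) :
    ∃ N : ℕ, ∀ (j : ℕ) (n : ℤ), N ≤ n → S.Y (S.g u j v) n w = 0 := by
  obtain ⟨L, hL⟩ := S.trunc u v
  choose M hM using fun j : ℕ => S.Y_trunc (S.g u j v) w
  refine ⟨∑ j ∈ Finset.range L, M j, fun j n hn => ?_⟩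
  by_cases hj : j < L
  · have h1 := Finset.single_le_sum (f := M) (fun _ _ => Nat.zero_le _) (Finset.mem_range.mpr hj)
    exact hM j n (by omega)
  · rw [hL j (by omega)]; simp

theorem D_Y (v : V) (n : ℤ) (w : V) :
    S.D (S.Y v n w) - S.Y v n (S.D w) = -(n • S.Y v (n - 1) w) := by
  let T : Submodule ℂ V :=
    { carrier := {w | ∀ v n, S.D (S.Y v n w) - S.Y v n (S.D w) = -(n • S.Y v (n - 1) w)}
      add_mem' := by
        intro a b ha hb v n
        simp only [map_add, smul_add, neg_add]
        rw [← ha, ← hb]; abel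
      zero_mem' := fun v n => by simp
      smul_mem' := by
        intro c a ha v n
        simp only [map_smul]
        rw [← smul_sub, ha, smul_neg, smul_comm] }
  refine S.ind T ?_ ?_ w v n
  · intro v n
    rw [S.D_vac, map_zero, Y_vac, Y_vac, S.D_E, show -1 - n + 1 = -1 - (n - 1) by ring, sub_zero,
      ← neg_smul]
    congr 1; ring
  · intro u p w hw v n
    obtain ⟨L, hL⟩ := S.trunc u v
    have hz : ∀ (x : V) (a b : ℤ) (i : ℕ), L ≤ i → S.Y (S.g u i v) (a + b - i) x = 0 :=
      fun x a b i hi => by rw [hL i (by omega)]; simp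
    have h1 := S.D_g u p w
    have h1' : S.g u p (S.D w) + -(p • S.g u (p - 1) w) = S.D (S.g u p w) := by rw [← h1]; abel
    have h2 := S.D_g u p (S.Y v n w)
    have h3 := hw v n
    rw [← h1', map_add, map_neg, map_zsmul, Y_g, Y_g, Y_g, Y_g, map_sub,
      show S.D (bsum p fun j => S.Y (S.g u j v) (p + n - j) w) = _ from
        bsum_map S.D.toAddMonoidHom p L (hz w p n)]
    have h4 : (bsum p fun j => S.D (S.Y (S.g u j v) (p + n - j) w)) -
        (bsum p fun j => S.Y (S.g u j v) (p + n - j) (S.D w)) =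
        -(n • bsum p fun j => S.Y (S.g u j v) (p + (n - 1) - j) w) -
        p • bsum (p - 1) fun j => S.Y (S.g u j v) (p - 1 + n - j) w := by
      rw [← bsum_sub p L (fun i hi => by rw [hz w p n i hi, map_zero]) (hz _ p n),
        ← bsum_weight' p L (hz w (p - 1) n), bsum_smul p n L (hz w p (n - 1)), ← neg_add',
        ← bsum_add p L (fun i hi => by rw [hz w p (n - 1) i hi, smul_zero])
          (fun i hi => by rw [hz w (p - 1) n i hi, smul_zero]),
        ← neg_one_smul ℤ, bsum_smul p (-1) L (fun i hi => by
          rw [hz w (p - 1) n i hi, hz w p (n - 1) i hi, smul_zero, smul_zero, add_zero])]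
      congr 1
      funext j
      rw [hw (S.g u j v) (p + n - j), show p + n - (j : ℤ) - 1 = p + (n - 1) - j by ring,
        show p - 1 + n - (j : ℤ) = p + (n - 1) - j by ring, ← add_smul, neg_one_smul]
      congr 2
      ring
    simp only [LinearMap.toAddMonoidHom_coe]
    have h3' := congrArg (S.g u p) h3
    rw [map_sub, map_neg, map_zsmul] at h3'
    linear_combination (norm := module) h2 + h3' - h4

theorem Y_gen (u : C) (n : ℤ) (w : V) : S.Y (S.g u (-1) S.vac) n w = S.g u n w := by
  let T : Submodule ℂ V :=
    { carrier := {w | ∀ u n, S.Y (S.g u (-1) S.vac) n w = S.g u n w}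
      add_mem' := by intro a b ha hb u n; rw [map_add, map_add, ha, hb]
      zero_mem' := fun v n => by simp
      smul_mem' := by intro c a ha u n; rw [map_smul, map_smul, ha] }
  have hD : ∀ (u : C) (k : ℕ), S.E k (S.g u (-1) S.vac) = S.g u (-1 - k) S.vac := by
    intro u k
    induction k with
    | zero => simp [S.E_zero]
    | succ k ih =>
      have h1 := S.D_E k (S.g u (-1) S.vac)
      have h2 := S.D_g u (-1 - k) S.vac
      rw [S.D_vac, map_zero, sub_zero, ← neg_smul] at h2
      rw [ih, h2] at h1
      refine GenSys.zsmul_cancel (n := (k : ℤ) + 1) (by omega) ?_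
      push_cast
      rw [← h1, show -(-1 - (k : ℤ)) = k + 1 by ring, show -1 - (k : ℤ) - 1 = -1 - (k + 1) by ring]
  refine S.ind T ?_ ?_ w u n
  · intro u n
    rw [Y_vac]
    rcases lt_or_ge (-1 - n) 0 with h | h
    · rw [S.E_neg h, S.g_vac u n (by omega)]; rfl
    · obtain ⟨k, hk⟩ := Int.eq_ofNat_of_zero_le h
      rw [hk, hD]; congr 2; omega
  · intro a p w hw u n
    have hj : ∀ j : ℕ, S.g a j (S.g u (-1) S.vac) =
        S.g (S.op0 a u) (j - 1) S.vac + (j : ℤ) • S.g (S.op1 a u) (j - 2) S.vac := by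
      intro j
      have := S.comm a u j (-1) S.vac
      rw [S.g_vac a j (by omega), map_zero, sub_zero] at this
      rw [this]; congr 3; ring_nf
    rw [Y_g, hw u n, bsum_eq_range p 2 fun i hi => by
      rw [hj, S.g_vac _ _ (by omega), S.g_vac _ _ (by omega)]; simp]
    have h0 : S.g a (0 : ℕ) (S.g u (-1) S.vac) = S.g (S.op0 a u) (-1) S.vac := by
      rw [hj]; simp
    have h1 : S.g a (1 : ℕ) (S.g u (-1) S.vac) = S.g (S.op1 a u) (-1) S.vac := by
      rw [hj, S.g_vac _ _ (by simp)]; simp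
    have hc := S.comm a u p n w
    rw [Finset.sum_range_succ, Finset.sum_range_one, h0, h1, hw, hw]
    simp only [Ring.choose_zero_right, Ring.choose_one_right, one_smul, Nat.cast_zero, sub_zero,
      Nat.cast_one]
    rw [← hc]; abel

end FieldSys


namespace FieldSys

variable {C V : Type*} [AddCommGroup V] [Module ℂ V] (S : FieldSys C V)

/-- The coefficient `∑ (-1)^i (l choose i) x_{m+l-i} y_{n+i} w`. -/
def X (x y : V) (l m n : ℤ) (w : V) : V :=
  bsum l fun i => (-1 : ℤ) ^ i • S.Y x (m + l - i) (S.Y y (n + i) w)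

/-- The difference of the two sides of the coefficient form of the Jacobi identity. -/
def K (x y : V) (l m n : ℤ) (w : V) : V :=
  S.X x y l m n w - (l.negOnePow : ℤ) • S.X y x l n m w -
    bsum m fun i => S.Y (S.Y x (l + i) y) (m + n - i) w

theorem X_rec (x y : V) (l m n : ℤ) (w : V) :
    S.X x y (l + 1) m n w = S.X x y l (m + 1) n w - S.X x y l m (n + 1) w := by
  obtain ⟨N, hN⟩ := S.Y_trunc y w
  have hz : ∀ (a b : ℤ) (i : ℕ), N + n.natAbs ≤ i →
      (-1 : ℤ) ^ i • S.Y x a (S.Y y (n + i) w) = 0 :=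
    fun a b i hi => by rw [hN _ (by omega)]; simp
  have hz' : ∀ (a b : ℤ) (i : ℕ), N + n.natAbs ≤ i →
      (-1 : ℤ) ^ i • S.Y x a (S.Y y (n + 1 + i) w) = 0 :=
    fun a b i hi => by rw [hN _ (by omega)]; simp
  unfold X
  rw [bsum_succ l (N + n.natAbs) (fun i hi => hz _ 0 i hi), sub_eq_add_neg, ← neg_one_smul ℤ (bsum l _),
    bsum_smul l (-1) (N + n.natAbs) (fun i hi => hz' _ 0 i hi)]
  congr 1
  · congr 1; funext i; rw [show m + (l + 1) - (i : ℤ) = m + 1 + l - i by ring]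
  · congr 1; funext i
    push_cast
    rw [show m + (l + 1) - ((i : ℤ) + 1) = m + l - i by ring,
      show n + ((i : ℤ) + 1) = n + 1 + i by ring, smul_smul, pow_succ']

theorem K_rec (x y : V) (l m n : ℤ) (w : V) :
    S.K x y l (m + 1) n w = S.K x y (l + 1) m n w + S.K x y l m (n + 1) w := by
  obtain ⟨N, hN⟩ := S.Y_trunc x y
  have h := bsum_succ m (f := fun i => S.Y (S.Y x (l + i) y) (m + 1 + n - i) w) (N + l.natAbs)
    (fun i hi => by rw [hN _ (by omega)]; simp)
  unfold K
  rw [X_rec, X_rec, h, Int.negOnePow_succ]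
  have e1 : (bsum m fun i : ℕ => S.Y (S.Y x (l + (i + 1 : ℕ)) y) (m + 1 + n - (i + 1 : ℕ)) w) =
      bsum m fun i => S.Y (S.Y x (l + 1 + i) y) (m + n - i) w := by
    congr 1; funext i; push_cast
    rw [show l + ((i : ℤ) + 1) = l + 1 + i by ring,
      show m + 1 + n - ((i : ℤ) + 1) = m + n - i by ring]
  have e2 : (bsum m fun i : ℕ => S.Y (S.Y x (l + i) y) (m + 1 + n - i) w) =
      bsum m fun i => S.Y (S.Y x (l + i) y) (m + (n + 1) - i) w := by
    congr 1; funext i; rw [show m + 1 + n - (i : ℤ) = m + (n + 1) - i by ring]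
  rw [e1, e2]
  push_cast
  module

theorem X_g (x y : V) (l m n : ℤ) (u : C) (p : ℤ) (w : V) :
    S.X x y l m n (S.g u p w) = S.g u p (S.X x y l m n w) -
      ((bsum p fun j => S.X (S.g u j x) y l (m + p - j) n w) +
        bsum p fun j => S.X x (S.g u j y) l m (n + p - j) w) := by
  obtain ⟨N, hN⟩ := S.Y_trunc y w
  obtain ⟨N', hN'⟩ := S.Y_trunc_g u y w
  obtain ⟨L, hL⟩ := S.trunc u x
  obtain ⟨L', hL'⟩ := S.trunc u y
  set M := N + N' + L + L' + n.natAbs + p.natAbs with hM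
  have z1 : ∀ (i : ℕ) (a : ℤ), M ≤ i → (-1 : ℤ) ^ i • S.Y x a (S.Y y (n + i) w) = 0 :=
    fun i a hi => by rw [hN _ (by omega)]; simp
  have z2 : ∀ (i j : ℕ) (a : ℤ), M ≤ i →
      (-1 : ℤ) ^ i • S.Y (S.g u j x) a (S.Y y (n + i) w) = 0 :=
    fun i j a hi => by rw [hN _ (by omega)]; simp
  have z3 : ∀ (i j : ℕ) (a : ℤ), M ≤ j →
      (-1 : ℤ) ^ i • S.Y (S.g u j x) a (S.Y y (n + i) w) = 0 :=
    fun i j a hi => by rw [hL _ (by omega)]; simp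
  have z4 : ∀ (i j : ℕ) (a : ℤ), M ≤ i →
      (-1 : ℤ) ^ i • S.Y x a (S.Y (S.g u j y) (n + p - j + i) w) = 0 := fun i j a hi => by
    by_cases hj : L' ≤ j
    · rw [hL' _ (by omega)]; simp
    · rw [hN' _ _ (by omega)]; simp
  have z5 : ∀ (i j : ℕ) (a : ℤ), M ≤ j →
      (-1 : ℤ) ^ i • S.Y x a (S.Y (S.g u j y) (n + p - j + i) w) = 0 :=
    fun i j a hi => by rw [hL' _ (by omega)]; simp
  have key : ∀ i : ℕ, (-1 : ℤ) ^ i • S.Y x (m + l - i) (S.Y y (n + i) (S.g u p w)) =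
      S.g u p ((-1 : ℤ) ^ i • S.Y x (m + l - i) (S.Y y (n + i) w)) -
      ((bsum p fun j => (-1 : ℤ) ^ i • S.Y (S.g u j x) (m + p - j + l - i) (S.Y y (n + i) w)) +
      bsum p fun j => (-1 : ℤ) ^ i • S.Y x (m + l - i) (S.Y (S.g u j y) (n + p - j + i) w)) := by
    intro i
    have e1 := bsum_map (S.Y x (m + l - i)).toAddMonoidHom p
      (f := fun j => S.Y (S.g u j y) (p + (n + i) - j) w) L'
      (fun j hj => by rw [hL' _ (by omega)]; simp)
    simp only [LinearMap.toAddMonoidHom_coe] at e1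
    rw [Y_g, map_sub, Y_g, e1,
      ← bsum_smul p ((-1) ^ i) L (fun j hj => by rw [hL _ (by omega)]; simp),
      ← bsum_smul p ((-1) ^ i) L' (fun j hj => by rw [hL' _ (by omega)]; simp), map_zsmul,
      smul_sub, smul_sub, sub_sub]
    congr 2
    · congr 2; funext j; rw [show p + (m + l - (i : ℤ)) - j = m + p - j + l - i by ring]
    · congr 2; funext j; rw [show p + (n + (i : ℤ)) - j = n + p - j + i by ring]
  unfold X
  simp_rw [key]
  have hb : ∀ i : ℕ, M ≤ i →
      (bsum p fun j => (-1 : ℤ) ^ i • S.Y (S.g u j x) (m + p - j + l - i) (S.Y y (n + i) w)) = 0 :=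
    fun i hi => by simp only [z2 i _ _ hi, bsum_zero]
  have hb' : ∀ i : ℕ, M ≤ i →
      (bsum p fun j => (-1 : ℤ) ^ i • S.Y x (m + l - i) (S.Y (S.g u j y) (n + p - j + i) w)) = 0 :=
    fun i hi => by simp only [z4 i _ _ hi, bsum_zero]
  rw [bsum_sub l M (fun i hi => by rw [z1 i _ hi, map_zero])
    (fun i hi => by rw [hb i hi, hb' i hi, add_zero]), bsum_add l M hb hb',
    bsum_comm l p M (f := fun i j : ℕ =>
      (-1 : ℤ) ^ i • S.Y (S.g u j x) (m + p - j + l - i) (S.Y y (n + i) w))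
      (fun i j hi => z2 i j _ hi) (fun i j hj => z3 i j _ hj),
    bsum_comm l p M (f := fun i j : ℕ =>
      (-1 : ℤ) ^ i • S.Y x (m + l - i) (S.Y (S.g u j y) (n + p - j + i) w))
      (fun i j hi => z4 i j _ hi) (fun i j hj => z5 i j _ hj)]
  congr 1
  exact (bsum_map (S.g u p).toAddMonoidHom l M (fun i hi => z1 i _ hi)).symm

/-- The modes `g u p` move through the iterate side of the Jacobi identity. -/
theorem H_g (x y : V) (l m n : ℤ) (u : C) (p : ℤ) (w : V) :
    (bsum m fun i => S.Y (S.Y x (l + i) y) (m + n - i) (S.g u p w)) =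
      S.g u p (bsum m fun i => S.Y (S.Y x (l + i) y) (m + n - i) w) -
      ((bsum p fun j => bsum (m + p - j) fun i =>
          S.Y (S.Y (S.g u j x) (l + i) y) (m + p - j + n - i) w) +
        bsum p fun j => bsum m fun i => S.Y (S.Y x (l + i) (S.g u j y)) (m + (n + p - j) - i) w) := by
  obtain ⟨N, hN⟩ := S.Y_trunc x y
  obtain ⟨N', hN'⟩ := S.Y_trunc_g u x y
  obtain ⟨L, hL⟩ := S.trunc u x
  obtain ⟨L', hL'⟩ := S.trunc u y
  choose Q hQ using fun j : ℕ => S.Y_trunc x (S.g u j y)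
  set M := N + N' + L + L' + l.natAbs + ∑ j ∈ Finset.range L', Q j with hM
  have z1 : ∀ (i : ℕ) (a : ℤ), M ≤ i → S.Y (S.Y x (l + i) y) a w = 0 :=
    fun i a hi => by rw [hN _ (by omega)]; simp
  have z2 : ∀ (i j : ℕ) (a : ℤ), M ≤ j → S.Y (S.Y x (l + i) (S.g u j y)) a w = 0 :=
    fun i j a hi => by rw [hL' _ (by omega)]; simp
  have z3 : ∀ (i j : ℕ) (a : ℤ), M ≤ i → S.Y (S.Y x (l + i) (S.g u j y)) a w = 0 := by
    intro i j a hi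
    by_cases hj : j < L'
    · have h1 := Finset.single_le_sum (f := Q) (fun _ _ => Nat.zero_le _) (Finset.mem_range.mpr hj)
      rw [hQ j _ (by omega)]; simp
    · rw [hL' _ (by omega)]; simp
  have z4 : ∀ (s r : ℕ) (a : ℤ), M ≤ r → S.Y (S.Y (S.g u s x) (l + r) y) a w = 0 :=
    fun s r a hr => by rw [hN' _ _ (by omega)]; simp
  have z5 : ∀ (s : ℕ) (a b : ℤ), M ≤ s → S.Y (S.Y (S.g u s x) a y) b w = 0 :=
    fun s a b hr => by rw [hL _ (by omega)]; simp
  -- the contribution of a fixed `i`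
  have key : ∀ i : ℕ, S.Y (S.Y x (l + i) y) (m + n - i) (S.g u p w) =
      S.g u p (S.Y (S.Y x (l + i) y) (m + n - i) w) -
      ((bsum p fun s => bsum (p - s) fun j =>
        S.Y (S.Y (S.g u s x) (l + (i + j : ℕ)) y) (m + p - s + n - (i + j : ℕ)) w) +
      bsum p fun j => S.Y (S.Y x (l + i) (S.g u j y)) (m + (n + p - j) - i) w) := by
    intro i
    have e0 : ∀ j : ℕ, S.Y (S.g u j (S.Y x (l + i) y)) (p + (m + n - i) - j) w =
        (bsum (j : ℤ) fun s =>
          S.Y (S.Y (S.g u s x) (j + (l + i) - s) y) (p + (m + n - i) - j) w) +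
        S.Y (S.Y x (l + i) (S.g u j y)) (m + (n + p - j) - i) w := by
      intro j
      have h1 := S.Y_g x (l + i) u j y
      have h2 := bsum_map ((LinearMap.applyₗ w) ∘ₗ (LinearMap.proj (p + (m + n - i) - j)) ∘ₗ
        S.Y).toAddMonoidHom (j : ℤ) (f := fun s => S.Y (S.g u s x) (j + (l + i) - s) y) L
        (fun s hs => by rw [hL _ (by omega)]; simp)
      simp only [LinearMap.toAddMonoidHom_coe, LinearMap.coe_comp, Function.comp_apply,
        LinearMap.proj_apply, LinearMap.applyₗ_apply_apply] at h2
      rw [← h2, show m + (n + p - j) - (i : ℤ) = p + (m + n - i) - j by ring, ← LinearMap.add_apply,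
        ← Pi.add_apply, ← map_add, h1]
      congr 3
      abel_nf
    have zz : ∀ j : ℕ, M + i + L + L' ≤ j →
        S.Y (S.Y x (l + i) (S.g u j y)) (m + (n + p - j) - i) w = 0 :=
      fun j hj => z2 i j _ (by omega)
    have zt : ∀ (s j : ℕ), M + i + L + L' ≤ s →
        S.Y (S.Y (S.g u s x) (j + (l + i) - s) y) (p + (m + n - i) - j) w = 0 :=
      fun s j hs => z5 s _ _ (by omega)
    have zt' : ∀ (s j : ℕ), M + i + L + L' ≤ j →
        S.Y (S.Y (S.g u s x) (j + (l + i) - s) y) (p + (m + n - i) - j) w = 0 := by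
      intro s j hj
      by_cases hs : s < L
      · rw [hN' _ _ (by omega)]; simp
      · rw [hL _ (by omega)]; simp
    rw [Y_g]
    simp_rw [e0]
    rw [bsum_add p (M + i + L + L') (fun j hj => by simp only [zt' _ j hj, bsum_zero]) zz,
      bsum_trinom p (M + i + L + L') zt zt']
    congr 3
    funext s
    congr 1
    funext j
    push_cast
    rw [show (s : ℤ) + j + (l + i) - s = l + (i + j) by ring,
      show p + (m + n - (i : ℤ)) - (s + j) = m + p - s + n - (i + j) by ring]
  simp_rw [key]
  have y1 : ∀ i : ℕ, M ≤ i → (bsum p fun s => bsum (p - s) fun j =>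
        S.Y (S.Y (S.g u s x) (l + (i + j : ℕ)) y) (m + p - s + n - (i + j : ℕ)) w) = 0 := by
    intro i hi
    have : ∀ s j : ℕ,
        S.Y (S.Y (S.g u s x) (l + (i + j : ℕ)) y) (m + p - s + n - (i + j : ℕ)) w = 0 :=
      fun s j => z4 _ _ _ (by omega)
    simp only [this, bsum_zero]
  have y2 : ∀ i : ℕ, M ≤ i →
      (bsum p fun j => S.Y (S.Y x (l + i) (S.g u j y)) (m + (n + p - j) - i) w) = 0 :=
    fun i hi => by simp only [z3 i _ _ hi, bsum_zero]
  rw [bsum_sub m M (fun i hi => by rw [z1 i _ hi, map_zero])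
    (fun i hi => by rw [y1 i hi, y2 i hi, add_zero]), bsum_add m M y1 y2]
  have c1 := bsum_map (S.g u p).toAddMonoidHom m M
    (f := fun i => S.Y (S.Y x (l + i) y) (m + n - i) w) (fun i hi => z1 i _ hi)
  have c2 := bsum_comm m p M (f := fun i j : ℕ =>
      S.Y (S.Y x (l + i) (S.g u j y)) (m + (n + p - j) - i) w)
      (fun i j hi => z3 i j _ hi) (fun i j hj => z2 i j _ hj)
  have c3 := bsum_comm m p M (f := fun i s : ℕ => bsum (p - s) fun j =>
      S.Y (S.Y (S.g u s x) (l + (i + j : ℕ)) y) (m + p - s + n - (i + j : ℕ)) w)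
      (fun i s hi => by
        have : ∀ j : ℕ,
            S.Y (S.Y (S.g u s x) (l + (i + j : ℕ)) y) (m + p - s + n - (i + j : ℕ)) w = 0 :=
          fun j => z4 _ _ _ (by omega)
        simp only [this, bsum_zero])
      (fun i s hs => by simp only [z5 s _ _ hs, bsum_zero])
  simp only [LinearMap.toAddMonoidHom_coe] at c1
  rw [c1, c2, c3]
  congr 3
  funext s
  rw [bsum_diag m (p - s) (h := fun r : ℕ =>
    S.Y (S.Y (S.g u s x) (l + r) y) (m + p - s + n - r) w) M (fun r hr => z4 _ _ _ hr),
    show m + (p - (s : ℤ)) = m + p - s by ring]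

theorem K_g (x y : V) (l m n : ℤ) (u : C) (p : ℤ) (w : V)
    (h0 : S.K x y l m n w = 0)
    (h1 : ∀ j : ℕ, S.K (S.g u j x) y l (m + p - j) n w = 0)
    (h2 : ∀ j : ℕ, S.K x (S.g u j y) l m (n + p - j) w = 0) :
    S.K x y l m n (S.g u p w) = 0 := by
  obtain ⟨L, hL⟩ := S.trunc u x
  obtain ⟨L', hL'⟩ := S.trunc u y
  have zX : ∀ (y : V) (l m n : ℤ), S.X 0 y l m n w = 0 := fun y l m n => by
    simp [X, bsum_zero]
  have zX' : ∀ (y : V) (l m n : ℤ), S.X y 0 l m n w = 0 := fun y l m n => by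
    simp [X, bsum_zero]
  have e : ∀ (f1 f2 f3 : ℕ → V) (N : ℕ) (_ : ∀ i, N ≤ i → f1 i = 0) (_ : ∀ i, N ≤ i → f2 i = 0)
      (_ : ∀ i, f1 i - (l.negOnePow : ℤ) • f2 i - f3 i = 0),
      bsum p f1 - (l.negOnePow : ℤ) • bsum p f2 - bsum p f3 = 0 := by
    intro f1 f2 f3 N a1 a2 a3
    rw [bsum_smul p _ N a2, ← bsum_sub p N a1 (fun i hi => by rw [a2 i hi, smul_zero]), sub_eq_zero]
    congr 1
    funext i
    exact sub_eq_zero.mp (a3 i)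
  have e1 := e (fun j => S.X (S.g u j x) y l (m + p - j) n w)
    (fun j => S.X y (S.g u j x) l n (m + p - j) w) _ L
    (fun j hj => by rw [hL _ (by omega), zX]) (fun j hj => by rw [hL _ (by omega), zX']) h1
  have e2 := e (fun j => S.X x (S.g u j y) l m (n + p - j) w)
    (fun j => S.X (S.g u j y) x l (n + p - j) m w) _ L'
    (fun j hj => by rw [hL' _ (by omega), zX']) (fun j hj => by rw [hL' _ (by omega), zX]) h2
  have h0' := congrArg (S.g u p) h0
  unfold K at h0' ⊢
  rw [map_sub, map_sub, map_zsmul, map_zero] at h0'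
  rw [X_g, X_g, H_g]
  linear_combination (norm := module) h0' - e1 - e2

end FieldSys

theorem K_propagate {V : Type*} [AddCommGroup V] (K : ℤ → ℤ → ℤ → V)
    (hrec : ∀ l m n, K l (m + 1) n = K (l + 1) m n + K l m (n + 1))
    (h0 : ∀ l n, K l 0 n = 0) (h1 : ∀ m n, K 0 m n = 0) (l m n : ℤ) : K l m n = 0 := by
  induction l using Int.induction_on generalizing m n with
  | zero => exact h1 m n
  | succ l ih =>
    have := hrec l m n
    rw [ih, ih, add_zero] at this
    exact this.symm
  | pred l ih =>
    have hr : ∀ m n, K (-l - 1) (m + 1) n = K (-l - 1) m (n + 1) := by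
      intro m n
      rw [hrec, sub_add_cancel, ih, zero_add]
    induction m using Int.induction_on generalizing n with
    | zero => exact h0 _ n
    | succ m ihm => rw [hr, ihm]
    | pred m ihm =>
      have := hr (-m - 1) (n - 1)
      rw [sub_add_cancel, sub_add_cancel, ihm] at this
      exact this.symm


namespace FieldSys

variable {C V : Type*} [AddCommGroup V] [Module ℂ V] (S : FieldSys C V)

theorem X_vac (x y : V) (l m n : ℤ) :
    S.X x y l m n S.vac = bsum l fun i => (-1 : ℤ) ^ i • S.Y x (m + l - i) (S.E (-1 - n - i) y) := by
  unfold X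
  congr 1; funext i
  rw [Y_vac, show -1 - (n + (i : ℤ)) = -1 - n - i by ring]

theorem X_vac_of_nonneg (x y : V) (l m n : ℤ) (hn : 0 ≤ n) : S.X x y l m n S.vac = 0 := by
  rw [X_vac]
  have : ∀ i : ℕ, (-1 : ℤ) ^ i • S.Y x (m + l - i) (S.E (-1 - n - i) y) = 0 := fun i => by
    rw [S.E_neg (by omega)]; simp
  simp only [this, bsum_zero]

theorem X_vac_zero (x y : V) (l n : ℤ) : S.X x y l 0 n S.vac = S.E (-1 - n) (S.Y x l y) := by
  rcases lt_or_ge (-1 - n) 0 with h | h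
  · rw [X_vac_of_nonneg _ _ _ _ _ _ (by omega), S.E_neg h]; rfl
  · obtain ⟨k, hk⟩ := Int.eq_ofNat_of_zero_le h
    rw [X_vac, hk, S.cov_E' (f := S.Y x) (S.D_Y x)]
    simp only [zero_add]

theorem K_vac_zero (x y : V) (l n : ℤ) : S.K x y l 0 n S.vac = 0 := by
  unfold K
  rw [X_vac_zero, X_vac_of_nonneg _ _ _ _ _ _ le_rfl, bsum_zero_left, Y_vac]
  simp

theorem K_zero_gen (u : C) (y : V) (m n : ℤ) (w : V) :
    S.K (S.g u (-1) S.vac) y 0 m n w = 0 := by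
  have h := S.Y_g y n u m w
  unfold K X
  rw [bsum_zero_left, bsum_zero_left]
  simp only [Y_gen, zero_add]
  simp only [pow_zero, one_smul, Nat.cast_zero, add_zero, sub_zero, Int.negOnePow_zero,
    Units.val_one]
  rw [h]
  abel

theorem K_add (x y : V) (l m n : ℤ) (a b : V) :
    S.K x y l m n (a + b) = S.K x y l m n a + S.K x y l m n b := by
  obtain ⟨N, hN⟩ := S.Y_trunc x a
  obtain ⟨N', hN'⟩ := S.Y_trunc x b
  obtain ⟨M, hM⟩ := S.Y_trunc y a
  obtain ⟨M', hM'⟩ := S.Y_trunc y b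
  obtain ⟨L, hL⟩ := S.Y_trunc x y
  unfold K X
  simp only [map_add, smul_add]
  rw [bsum_add l (M + M' + n.natAbs) (fun i hi => by rw [hM _ (by omega)]; simp)
      (fun i hi => by rw [hM' _ (by omega)]; simp),
    bsum_add l (N + N' + m.natAbs) (fun i hi => by rw [hN _ (by omega)]; simp)
      (fun i hi => by rw [hN' _ (by omega)]; simp),
    bsum_add m (L + l.natAbs) (fun i hi => by rw [hL _ (by omega)]; simp)
      (fun i hi => by rw [hL _ (by omega)]; simp)]
  module

theorem K_smul (x y : V) (l m n : ℤ) (c : ℂ) (a : V) :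
    S.K x y l m n (c • a) = c • S.K x y l m n a := by
  obtain ⟨N, hN⟩ := S.Y_trunc x a
  obtain ⟨M, hM⟩ := S.Y_trunc y a
  obtain ⟨L, hL⟩ := S.Y_trunc x y
  unfold K X
  have hs : ∀ (p : ℤ) (f : ℕ → V) (N : ℕ), (∀ i, N ≤ i → f i = 0) →
      (bsum p fun i => c • f i) = c • bsum p f := fun p f N h =>
    (bsum_map (DistribSMul.toAddMonoidHom V c) p N h).symm
  simp only [map_smul, smul_comm _ c]
  rw [hs l _ (M + n.natAbs) (fun i hi => by rw [hM _ (by omega)]; simp),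
    hs l _ (N + m.natAbs) (fun i hi => by rw [hN _ (by omega)]; simp),
    hs m _ (L + l.natAbs) (fun i hi => by rw [hL _ (by omega)]; simp)]
  module

theorem K_gen (u : C) (y : V) (l m n : ℤ) (w : V) : S.K (S.g u (-1) S.vac) y l m n w = 0 := by
  let T : Submodule ℂ V :=
    { carrier := {w | ∀ u y l m n, S.K (S.g u (-1) S.vac) y l m n w = 0}
      add_mem' := by intro a b ha hb u y l m n; rw [S.K_add, ha, hb, add_zero]
      zero_mem' := fun u y l m n => by
        have := S.K_smul (S.g u (-1) S.vac) y l m n 0 0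
        simpa using this
      smul_mem' := by intro c a ha u y l m n; rw [S.K_smul, ha, smul_zero] }
  have zK : ∀ y l m n w, S.K 0 y l m n w = 0 := by
    intro y l m n w
    simp [K, X, bsum_zero]
  refine S.ind T ?_ ?_ w u y l m n
  · intro u y l m n
    exact K_propagate (fun l m n => S.K (S.g u (-1) S.vac) y l m n S.vac)
      (fun l m n => S.K_rec _ _ l m n _) (fun l n => S.K_vac_zero _ _ l n)
      (fun m n => S.K_zero_gen u y m n _) l m n
  · intro a p w hw u y l m n
    refine S.K_g _ _ _ _ _ _ _ _ (hw u y l m n) (fun j => ?_) (fun j => hw u _ _ _ _)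
    have hj := S.comm a u j (-1) S.vac
    rw [S.g_vac a j (by omega), map_zero, sub_zero] at hj
    rw [hj]
    rcases Nat.lt_trichotomy j 1 with h | h | h
    · obtain rfl : j = 0 := by omega
      simpa using hw (S.op0 a u) y l (m + p) n
    · subst h
      rw [S.g_vac _ _ (by simp)]
      simpa using hw (S.op1 a u) y l (m + p - 1) n
    · rw [S.g_vac _ _ (by omega), S.g_vac _ _ (by omega), smul_zero, add_zero, zK]

/-- The product formula for the modes of `g u p w`. -/
theorem Y_g_left (u : C) (p : ℤ) (w : V) (q : ℤ) (v : V) :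
    S.Y (S.g u p w) q v = (bsum p fun s => (-1 : ℤ) ^ s • S.g u (p - s) (S.Y w (q + s) v)) -
      (p.negOnePow : ℤ) • bsum p fun s => (-1 : ℤ) ^ s • S.Y w (q + p - s) (S.g u s v) := by
  have h := S.K_gen u w p 0 q v
  unfold K X at h
  rw [bsum_zero_left] at h
  simp only [Y_gen, zero_add, Nat.cast_zero, add_zero, sub_zero] at h
  exact (sub_eq_zero.mp h).symm

/-- The right-hand side of the skew symmetry formula. -/
def Sk (v : V) (n : ℤ) (w : V) : V :=
  -((n.negOnePow : ℤ) • bsum (-1) fun i => S.E i (S.Y w (n + i) v))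

theorem Sk_g (v : V) (n : ℤ) (u : C) (p : ℤ) (w : V) : S.Sk v n (S.g u p w) =
    S.g u p (S.Sk v n w) - bsum p fun s => S.Sk (S.g u s v) (p + n - s) w := by
  obtain ⟨N, hN⟩ := S.Y_trunc w v
  obtain ⟨L, hL⟩ := S.trunc u v
  choose Q hQ using fun s : ℕ => S.Y_trunc w (S.g u s v)
  set M := N + n.natAbs + L + p.natAbs + ∑ j ∈ Finset.range L, Q j with hM
  let f : ℕ → ℕ → ℕ → V := fun i s j =>
    (-1 : ℤ) ^ j • S.g u (p - j) (S.E (i + s - j) (S.Y w (n + i + s) v))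
  have f1 : ∀ i s j, M ≤ i → f i s j = 0 := fun i s j h => by
    simp only [f]; rw [hN _ (by omega)]; simp
  have f2 : ∀ i s j, M ≤ s → f i s j = 0 := fun i s j h => by
    simp only [f]; rw [hN _ (by omega)]; simp
  have f3 : ∀ i s j, M ≤ j → f i s j = 0 := fun i s j h => by
    simp only [f]
    by_cases hh : (i : ℤ) + s < j
    · rw [S.E_neg (by omega)]; simp
    · rw [hN _ (by omega)]; simp
  have q1 : ∀ (i s : ℕ) (a : ℤ), M ≤ s → S.Y w a (S.g u s v) = 0 :=
    fun i s a h => by rw [hL _ (by omega)]; simp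
  have q2 : ∀ (i s : ℕ), M ≤ i → S.Y w (n + p - s + i) (S.g u s v) = 0 := by
    intro i s h
    by_cases hs : s < L
    · have h1 := Finset.single_le_sum (f := Q) (fun _ _ => Nat.zero_le _) (Finset.mem_range.mpr hs)
      exact hQ s _ (by omega)
    · rw [hL _ (by omega)]; simp
  -- first half
  have A : (bsum (-1) fun i : ℕ => S.E i (bsum p fun s =>
      (-1 : ℤ) ^ s • S.g u (p - s) (S.Y w (n + i + s) v))) =
      S.g u p (bsum (-1) fun i => S.E i (S.Y w (n + i) v)) := by
    have a1 : ∀ i : ℕ, S.E i (bsum p fun s => (-1 : ℤ) ^ s • S.g u (p - s) (S.Y w (n + i + s) v)) =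
        bsum p fun j => bsum (j : ℤ) fun s => f i s j := by
      intro i
      have b1 := bsum_map (S.E i).toAddMonoidHom p
        (f := fun s => (-1 : ℤ) ^ s • S.g u (p - s) (S.Y w (n + i + s) v)) M
        (fun s hs => by rw [hN _ (by omega)]; simp)
      simp only [LinearMap.toAddMonoidHom_coe, map_zsmul] at b1
      rw [b1, bsum_trinom p M (fun s j h => f2 i s j h) (fun s j h => f3 i s j h)]
      congr 1; funext s
      rw [S.cov_E' (f := S.g u) (S.D_g u), bsum_smul _ _ (i + 1) (fun t ht => by
        rw [S.E_neg (by omega)]; simp)]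
      congr 1; funext t
      simp only [f]
      push_cast
      rw [smul_smul, pow_add, show p - ((s : ℤ) + t) = p - s - t by ring,
        show (i : ℤ) + s - (s + t) = i - t by ring]
    simp_rw [a1]
    rw [bsum_comm (-1) p M (f := fun i j => bsum (j : ℤ) fun s => f i s j)
      (fun i j h => by simp only [f1 i _ j h, bsum_zero])
      (fun i j h => by simp only [f3 i _ j h, bsum_zero])]
    have a2 : ∀ j : ℕ, (bsum (-1) fun i => bsum (j : ℤ) fun s => f i s j) =
        if j = 0 then S.g u p (bsum (-1) fun i => S.E i (S.Y w (n + i) v)) else 0 := by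
      intro j
      rw [bsum_comm (-1) (j : ℤ) M (f := fun i s => f i s j) (fun i s h => f1 i s j h)
        (fun i s h => f2 i s j h)]
      let Z : V := bsum (-1) fun r : ℕ => S.g u (p - j) (S.E r (S.Y w (n + j + r) v))
      have a3 : (bsum (j : ℤ) fun s => bsum (-1) fun i => f i s j) =
          bsum (j : ℤ) fun s => (-1 : ℤ) ^ s • Z := by
        refine bsum_congr_nat j fun s hs => ?_
        rw [bsum_neg_one_shift (j - s) M (fun i h => f1 i s j h) (fun i hi => by
          simp only [f]; rw [S.E_neg (by omega)]; simp)]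
        have a4 : ∀ r : ℕ, f (j - s + r) s j =
            (-1 : ℤ) ^ j • S.g u (p - j) (S.E r (S.Y w (n + j + r) v)) := by
          intro r
          simp only [f]
          push_cast [Nat.cast_sub hs]
          rw [show (j : ℤ) - s + r + s - j = r by ring,
            show n + ((j : ℤ) - s + r) + s = n + j + r by ring]
        simp_rw [a4]
        rw [← bsum_smul _ _ M (fun r hr => by rw [hN _ (by omega)]; simp), smul_smul]
        congr 1
        obtain ⟨d, rfl⟩ := Nat.exists_eq_add_of_le hs
        rw [show s + d - s = d by omega, ← pow_add, show d + (s + d) = s + 2 * d by ring, pow_add,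
          pow_mul]
        simp
      rw [a3, bsum_natCast]
      simp_rw [smul_smul]
      rw [← Finset.sum_smul]
      have a5 : ∑ i ∈ Finset.range (j + 1), ((j.choose i : ℤ) * (-1) ^ i) =
          if j = 0 then 1 else 0 := by
        rw [← Int.alternating_sum_range_choose]
        exact Finset.sum_congr rfl fun i _ => mul_comm _ _
      rw [a5]
      split_ifs with hj
      · subst hj
        rw [one_smul]
        have := bsum_map (S.g u p).toAddMonoidHom (-1)
          (f := fun i => S.E i (S.Y w (n + i) v)) M (fun i hi => by rw [hN _ (by omega)]; simp)
        simp only [LinearMap.toAddMonoidHom_coe] at this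
        rw [this]
        simp [Z]
      · rw [zero_smul]
    simp_rw [a2]
    rw [bsum_eq_range p 1 (fun i hi => if_neg (by omega))]
    simp
  -- second half
  have B : (bsum (-1) fun i : ℕ => S.E i (bsum p fun s =>
      (-1 : ℤ) ^ s • S.Y w (n + i + p - s) (S.g u s v))) =
      bsum p fun s : ℕ => (-1 : ℤ) ^ s • bsum (-1) fun i : ℕ =>
        S.E i (S.Y w (p + n - s + i) (S.g u s v)) := by
    have b0 : ∀ i : ℕ, S.E i (bsum p fun s => (-1 : ℤ) ^ s • S.Y w (n + i + p - s) (S.g u s v)) =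
        bsum p fun s => (-1 : ℤ) ^ s • S.E i (S.Y w (n + p - s + i) (S.g u s v)) := by
      intro i
      have b1 := bsum_map (S.E i).toAddMonoidHom p
        (f := fun s => (-1 : ℤ) ^ s • S.Y w (n + i + p - s) (S.g u s v)) M
        (fun s hs => by rw [q1 0 s _ hs, smul_zero])
      simp only [LinearMap.toAddMonoidHom_coe, map_zsmul] at b1
      rw [b1]
      congr 1; funext s
      rw [show n + (i : ℤ) + p - s = n + p - s + i by ring]
    simp_rw [b0]
    rw [bsum_comm (-1) p M (f := fun i s : ℕ =>
      (-1 : ℤ) ^ s • S.E i (S.Y w (n + p - s + i) (S.g u s v)))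
      (fun i s h => by rw [q2 i s h]; simp) (fun i s h => by rw [q1 0 s _ h]; simp)]
    congr 1; funext s
    rw [← bsum_smul _ _ M (fun i h => by rw [q2 i s h]; simp), add_comm n p]
  have z1 : ∀ i : ℕ, M ≤ i → (bsum p fun s =>
      (-1 : ℤ) ^ s • S.g u (p - s) (S.Y w (n + i + s) v)) = 0 := by
    intro i hi
    have : ∀ s : ℕ, S.Y w (n + i + s) v = 0 := fun s => hN _ (by omega)
    simp only [this, map_zero, smul_zero, bsum_zero]
  have z2 : ∀ i : ℕ, M ≤ i → (bsum p fun s =>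
      (-1 : ℤ) ^ s • S.Y w (n + i + p - s) (S.g u s v)) = 0 := by
    intro i hi
    have : ∀ s : ℕ, S.Y w (n + i + p - s) (S.g u s v) = 0 := fun s => by
      rw [show n + (i : ℤ) + p - s = n + p - s + i by ring, q2 i s hi]
    simp only [this, smul_zero, bsum_zero]
  have main : (bsum (-1) fun i : ℕ => S.E i (S.Y (S.g u p w) (n + i) v)) =
      S.g u p (bsum (-1) fun i => S.E i (S.Y w (n + i) v)) - (p.negOnePow : ℤ) •
      bsum p fun s : ℕ => (-1 : ℤ) ^ s • bsum (-1) fun i : ℕ =>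
        S.E i (S.Y w (p + n - s + i) (S.g u s v)) := by
    rw [← A, ← B, bsum_smul _ _ M (fun i hi => by rw [z2 i hi, map_zero]),
      ← bsum_sub _ M (fun i hi => by rw [z1 i hi, map_zero])
        (fun i hi => by rw [z2 i hi, map_zero, smul_zero])]
    congr 1; funext i
    rw [Y_g_left, map_sub, map_zsmul]
  unfold Sk
  rw [main, map_neg, map_zsmul, smul_sub, neg_sub, sub_eq_neg_add, sub_eq_add_neg]
  congr 1
  rw [smul_smul, ← neg_one_smul ℤ (bsum p _), bsum_smul p _ M (fun s hs => by
      simp only [q1 0 s _ hs, map_zero, bsum_zero, smul_zero]),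
    bsum_smul p _ M (fun s hs => by
      simp only [q1 0 s _ hs, map_zero, bsum_zero, smul_zero, neg_zero])]
  congr 1; funext s
  rw [neg_one_smul, neg_neg, smul_smul]
  congr 1
  rw [Int.negOnePow_sub, Int.negOnePow_add]
  push_cast
  rw [Int.negOnePow_def (s : ℤ), zpow_natCast]
  push_cast
  ring

theorem vac_Y (n : ℤ) (w : V) : S.Y S.vac n w = if n = -1 then w else 0 := by
  let T : Submodule ℂ V :=
    { carrier := {w | ∀ n, S.Y S.vac n w = if n = -1 then w else 0}
      add_mem' := by intro a b ha hb n; rw [map_add, ha, hb]; split_ifs <;> simp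
      zero_mem' := fun n => by simp
      smul_mem' := by intro c a ha n; rw [map_smul, ha]; split_ifs <;> simp }
  refine S.ind T ?_ ?_ w n
  · intro n
    rw [Y_vac, S.E_vac]
    congr 1
    simp only [eq_iff_iff]
    omega
  · intro u p w hw n
    have : ∀ j : ℕ, S.g u j S.vac = 0 := fun j => S.g_vac u j (by omega)
    rw [Y_g, hw]
    simp only [this, map_zero, Pi.zero_apply, LinearMap.zero_apply, bsum_zero, sub_zero]
    split_ifs <;> simp

/-- Skew symmetry. -/
theorem skew (v : V) (n : ℤ) (w : V) : S.Y v n w = S.Sk v n w := by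
  let T : Submodule ℂ V :=
    { carrier := {w | ∀ v n, S.Y v n w = S.Sk v n w}
      add_mem' := by
        intro a b ha hb v n
        obtain ⟨N, hN⟩ := S.Y_trunc a v
        obtain ⟨M, hM⟩ := S.Y_trunc b v
        rw [map_add, ha, hb]
        unfold Sk
        simp only [map_add, Pi.add_apply, LinearMap.add_apply]
        rw [bsum_add _ (N + M + n.natAbs) (fun i hi => by rw [hN _ (by omega)]; simp)
          (fun i hi => by rw [hM _ (by omega)]; simp)]
        module
      zero_mem' := fun v n => by simp [Sk, bsum_zero]
      smul_mem' := by
        intro c a ha v n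
        obtain ⟨N, hN⟩ := S.Y_trunc a v
        rw [map_smul, ha]
        unfold Sk
        simp only [map_smul, Pi.smul_apply, LinearMap.smul_apply]
        have := bsum_map (DistribSMul.toAddMonoidHom V c) (-1)
          (f := fun i => S.E i (S.Y a (n + i) v)) (N + n.natAbs)
          (fun i hi => by rw [hN _ (by omega)]; simp)
        simp only [DistribSMul.toAddMonoidHom_apply] at this
        rw [← this]
        module }
  refine S.ind T ?_ ?_ w v n
  · intro v n
    unfold Sk
    simp only [vac_Y]
    rw [Y_vac]
    rcases lt_or_ge (-1 - n) 0 with h | h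
    · have : ∀ i : ℕ, (if n + (i : ℤ) = -1 then v else 0) = 0 := fun i => if_neg (by omega)
      simp only [this, map_zero, bsum_zero]
      rw [S.E_neg h]
      simp
    · obtain ⟨k, hk⟩ := Int.eq_ofNat_of_zero_le h
      rw [bsum_neg_one_shift k (k + 1) (fun i hi => by rw [if_neg (by omega), map_zero])
        (fun i hi => by rw [if_neg (by omega), map_zero]),
        bsum_eq_range _ 1 (fun i hi => by rw [if_neg (by push_cast; omega), map_zero])]
      have : n = -1 - k := by omega
      subst this
      simp only [Finset.sum_range_one, Ring.choose_zero_right, one_smul, add_zero, sub_add_cancel,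
        if_true, smul_smul]
      rw [Int.negOnePow_sub]
      simp only [Int.negOnePow_def]
      rw [← neg_smul]
      have h1 : -((((-1 : ℤˣ) ^ (-1 : ℤ) * (-1 : ℤˣ) ^ (k : ℤ) : ℤˣ) : ℤ) * (-1) ^ k) = 1 := by
        push_cast
        simp only [zpow_natCast, zpow_neg_one]
        push_cast
        rw [show ((-1 : ℤˣ)⁻¹ : ℤˣ) = -1 by rfl]
        push_cast
        rw [neg_mul, one_mul, neg_mul, neg_neg, ← mul_pow]
        simp
      rw [h1, one_smul]
      congr 2
  · intro u p w hw v n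
    rw [Y_g, Sk_g, hw]
    congr 2
    funext s
    rw [hw]

theorem K_vac_nonneg (x y : V) (m : ℕ) : ∀ l n : ℤ, S.K x y l m n S.vac = 0 := by
  induction m with
  | zero => intro l n; exact S.K_vac_zero x y l n
  | succ m ih => intro l n; push_cast; rw [K_rec, ih, ih, add_zero]

theorem K_vac_neg (x y : V) (k : ℕ) (l : ℤ) : S.K x y l (-1 - k) 0 S.vac = 0 := by
  unfold K
  rw [X_vac_of_nonneg _ _ _ _ _ _ le_rfl, X_vac_zero, S.skew y l x]
  unfold Sk
  obtain ⟨N, hN⟩ := S.Y_trunc x y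
  have hz : ∀ i : ℕ, N + l.natAbs ≤ i → S.E i (S.Y x (l + i) y) = 0 :=
    fun i hi => by rw [hN _ (by omega)]; simp
  have e := bsum_map (S.E k).toAddMonoidHom (-1) _ hz
  simp only [LinearMap.toAddMonoidHom_coe] at e
  rw [show -1 - (-1 - (k : ℤ)) = k by ring, map_neg, map_zsmul, e, smul_neg, smul_smul,
    ← Units.val_mul, ← Int.negOnePow_add, Int.negOnePow_even _ ⟨l, rfl⟩, Units.val_one, one_smul,
    zero_sub, neg_neg, sub_eq_zero]
  unfold bsum
  congr 1
  funext i
  simp only [Y_vac, S.E_E, smul_smul]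
  congr 2
  · rw [choose_neg_one, show (-1 - (k : ℤ)) = -(k + 1) by ring, Ring.choose_neg,
      show (k : ℤ) + 1 + i - 1 = ((k + i : ℕ) : ℤ) by push_cast; ring, Ring.choose_natCast,
      Int.negOnePow_def, Units.smul_def, Nat.choose_symm_add]
    simp
  · rw [show -1 - (-1 - (k : ℤ) + 0 - i) = k + i by ring]

theorem K_vac (x y : V) (l m n : ℤ) : S.K x y l m n S.vac = 0 := by
  rcases le_or_gt 0 m with h | h
  · obtain ⟨k, rfl⟩ := Int.eq_ofNat_of_zero_le h
    exact S.K_vac_nonneg x y k l n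
  · have main : ∀ k : ℕ, ∀ l n : ℤ, S.K x y l (-k) n S.vac = 0 := by
      intro k
      induction k with
      | zero => intro l n; exact S.K_vac_nonneg x y 0 l n
      | succ k ih =>
        have hr : ∀ l n, S.K x y (l + 1) (-1 - k) n S.vac = -S.K x y l (-1 - k) (n + 1) S.vac := by
          intro l n
          have := S.K_rec x y l (-1 - k) n S.vac
          rw [show -1 - (k : ℤ) + 1 = -k by ring, ih] at this
          exact eq_neg_of_add_eq_zero_left this.symm
        intro l n
        rw [show (-((k + 1 : ℕ) : ℤ)) = -1 - k by push_cast; ring]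
        induction n using Int.induction_on generalizing l with
        | zero => exact S.K_vac_neg x y k l
        | succ n ihn => 
          have := hr l n
          rw [ihn] at this
          exact neg_eq_zero.mp this.symm
        | pred n ihn =>
          have := hr (l - 1) (-n - 1)
          rw [sub_add_cancel, sub_add_cancel, ihn, neg_zero] at this
          exact this
    obtain ⟨k, hk⟩ := Int.eq_ofNat_of_zero_le (show 0 ≤ -m by omega)
    rw [show m = -k by omega]
    exact main k l n

end FieldSys


namespace FieldSys

variable {C V : Type*} [AddCommGroup V] [Module ℂ V] (S : FieldSys C V)

theorem K_eq_zero (x y : V) (l m n : ℤ) (w : V) : S.K x y l m n w = 0 := by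
  let T : Submodule ℂ V :=
    { carrier := {w | ∀ x y l m n, S.K x y l m n w = 0}
      add_mem' := by intro a b ha hb x y l m n; rw [S.K_add, ha, hb, add_zero]
      zero_mem' := fun x y l m n => by
        have := S.K_smul x y l m n 0 0
        simpa using this
      smul_mem' := by intro c a ha x y l m n; rw [S.K_smul, ha, smul_zero] }
  refine S.ind T ?_ ?_ w x y l m n
  · intro x y l m n; exact S.K_vac x y l m n
  · intro a p w hw x y l m n
    exact S.K_g _ _ _ _ _ _ _ _ (hw _ _ _ _ _) (fun j => hw _ _ _ _ _) (fun j => hw _ _ _ _ _)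

theorem jacobi : JacobiIdentity S.Y S.Y := by
  intro u v w l m n
  have h := S.K_eq_zero u v l m n w
  unfold K X at h
  rw [sub_eq_zero] at h
  obtain ⟨N, hN⟩ := S.Y_trunc v w
  obtain ⟨M, hM⟩ := S.Y_trunc u w
  have z1 : ∀ i : ℕ, N + M + n.natAbs + m.natAbs ≤ i →
      (-1 : ℤ) ^ i • S.Y u (m + l - i) (S.Y v (n + i) w) = 0 :=
    fun i hi => by rw [hN _ (by omega)]; simp
  have z2 : ∀ i : ℕ, N + M + n.natAbs + m.natAbs ≤ i →
      (-1 : ℤ) ^ i • S.Y v (n + l - i) (S.Y u (m + i) w) = 0 :=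
    fun i hi => by rw [hM _ (by omega)]; simp
  rw [bsum_smul _ _ _ z2, ← bsum_sub l _ z1 (fun i hi => by rw [z2 i hi, smul_zero])] at h
  refine Eq.trans ?_ h
  unfold bsum
  congr 1
  funext i
  module

/-- The vertex algebra structure attached to a field system. -/
@[reducible] def vertexAlgebra : VertexAlgebra V where
  vac := S.vac
  Y := S.Y
  trunc u v := by
    obtain ⟨N, hN⟩ := S.Y_trunc u v
    exact ⟨N, hN⟩
  vac_left := S.vac_Y
  vac_right v n hn := by rw [Y_vac, S.E_neg (by omega)]; rfl
  creation v := by rw [Y_vac, sub_self, S.E_zero]; rfl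
  jacobi := S.jacobi

/-- A subspace stable under the generating modes and under translation is a two-sided ideal. -/
theorem left_ideal (I : Submodule ℂ V) (hI : ∀ u n x, x ∈ I → S.g u n x ∈ I)
    (v : V) (n : ℤ) (x : V) (hx : x ∈ I) : S.Y v n x ∈ I := by
  let T : Submodule ℂ V :=
    { carrier := {v | ∀ n x, x ∈ I → S.Y v n x ∈ I}
      add_mem' := by
        intro a b ha hb n x hx
        simp only [map_add, Pi.add_apply, LinearMap.add_apply]
        exact I.add_mem (ha n x hx) (hb n x hx)
      zero_mem' := fun n x _ => by simp
      smul_mem' := by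
        intro c a ha n x hx
        simp only [map_smul, Pi.smul_apply, LinearMap.smul_apply]
        exact I.smul_mem c (ha n x hx) }
  have hb : ∀ (p : ℤ) (f : ℕ → V), (∀ i, f i ∈ I) → bsum p f ∈ I := fun p f hf =>
    finsum_induction (· ∈ I) I.zero_mem (fun _ _ => I.add_mem) fun i =>
      I.toAddSubgroup.zsmul_mem (hf i) _
  refine S.ind T ?_ ?_ v n x hx
  · intro n x hx
    rw [vac_Y]
    split_ifs
    · exact hx
    · exact I.zero_mem
  · intro u p w hw n x hx
    rw [Y_g_left]
    refine I.sub_mem (hb _ _ fun i => I.toAddSubgroup.zsmul_mem (hI _ _ _ (hw _ _ hx)) _)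
      (I.toAddSubgroup.zsmul_mem (hb _ _ fun i =>
        I.toAddSubgroup.zsmul_mem (hw _ _ (hI _ _ _ hx)) _) _)

theorem right_ideal (I : Submodule ℂ V) (hI : ∀ u n x, x ∈ I → S.g u n x ∈ I)
    (hD : ∀ x ∈ I, S.D x ∈ I) (v : V) (n : ℤ) (x : V) (hx : x ∈ I) : S.Y x n v ∈ I := by
  have hb : ∀ (p : ℤ) (f : ℕ → V), (∀ i, f i ∈ I) → bsum p f ∈ I := fun p f hf =>
    finsum_induction (· ∈ I) I.zero_mem (fun _ _ => I.add_mem) fun i =>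
      I.toAddSubgroup.zsmul_mem (hf i) _
  have hE : ∀ (i : ℕ) y, y ∈ I → S.E i y ∈ I := by
    intro i y hy
    simp only [GenSys.E, Int.natCast_nonneg, if_true, Int.toNat_natCast, LinearMap.smul_apply]
    refine I.smul_mem _ ?_
    induction i with
    | zero => simpa using hy
    | succ i ih => rw [pow_succ', Module.End.mul_apply]; exact hD _ ih
  rw [S.skew]
  exact I.neg_mem (I.toAddSubgroup.zsmul_mem
    (hb _ _ fun i => hE i _ (S.left_ideal I hI _ _ _ hx)) _)

end FieldSys

namespace VertexAlgebra

/-- The quotient of a vertex algebra by a (two-sided) ideal. -/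
@[reducible] def quotient {V : Type*} [AddCommGroup V] [Module ℂ V] (𝒱 : VertexAlgebra V) (I : Submodule ℂ V)
    (hl : ∀ v n, ∀ x ∈ I, 𝒱.Y v n x ∈ I) (hr : ∀ v n, ∀ x ∈ I, 𝒱.Y x n v ∈ I) :
    VertexAlgebra (V ⧸ I) where
  vac := I.mkQ 𝒱.vac
  Y := LinearMap.pi fun n => I.liftQ
    { toFun := fun v => I.mapQ I (𝒱.Y v n) (hl v n)
      map_add' := fun v w => by ext; simp
      map_smul' := fun c v => by ext; simp }
    (fun x hx => by
      ext v
      simpa using hr v n x hx)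
  trunc u v := by
    induction u using Submodule.Quotient.induction_on with | _ u
    induction v using Submodule.Quotient.induction_on with | _ v
    obtain ⟨N, hN⟩ := 𝒱.trunc u v
    exact ⟨N, fun n hn => congrArg I.mkQ (hN n hn)⟩
  vac_left n v := by
    induction v using Submodule.Quotient.induction_on with | _ v
    refine (congrArg I.mkQ (𝒱.vac_left n v)).trans ?_
    split_ifs <;> simp
  vac_right v n hn := by
    induction v using Submodule.Quotient.induction_on with | _ v
    exact congrArg I.mkQ (𝒱.vac_right v n hn)
  creation v := by
    induction v using Submodule.Quotient.induction_on with | _ v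
    exact congrArg I.mkQ (𝒱.creation v)
  jacobi := by
    intro u v w l m n
    induction u using Submodule.Quotient.induction_on with | _ u
    induction v using Submodule.Quotient.induction_on with | _ v
    induction w using Submodule.Quotient.induction_on with | _ w
    obtain ⟨N, hN⟩ := 𝒱.trunc v w
    obtain ⟨M, hM⟩ := 𝒱.trunc u w
    obtain ⟨L, hL⟩ := 𝒱.trunc u v
    have h := congrArg I.mkQ.toAddMonoidHom (𝒱.jacobi u v w l m n)
    have fin : ∀ (f : ℕ → V) (k : ℕ), (∀ i, k ≤ i → f i = 0) → (Function.support f).Finite :=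
      fun f k hk => (Set.finite_lt_nat k).subset fun i hi => by
        by_contra hc
        exact hi (hk i (not_lt.mp hc))
    rw [AddMonoidHom.map_finsum _ (fin _ (N.natAbs + M.natAbs + m.natAbs + n.natAbs) fun i hi => by
        rw [hN _ (by omega), hM _ (by omega)]; simp),
      AddMonoidHom.map_finsum _ (fin _ (L.natAbs + l.natAbs) fun i hi => by
        rw [hL _ (by omega)]; simp)] at h
    refine Eq.trans ?_ (h.trans ?_)
    · congr 1
    · congr 1

end VertexAlgebra


/-- A vertex `A`-algebroid structure on the complex vector space `B`, where `A` is a unital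
commutative associative `ℂ`-algebra. -/
class VertexAlgebroid (A B : Type*) [CommRing A] [Algebra ℂ A] [AddCommGroup B] [Module ℂ B] where
  star : A →ₗ[ℂ] B →ₗ[ℂ] B
  one_star : ∀ v : B, star 1 v = v
  bracket : B →ₗ[ℂ] B →ₗ[ℂ] B
  leibniz : ∀ u v w : B, bracket u (bracket v w) = bracket (bracket u v) w + bracket v (bracket u w)
  π : B →ₗ[ℂ] Derivation ℂ A A
  π_bracket : ∀ u v : B, π (bracket u v) = ⁅π u, π v⁆
  pairing : B →ₗ[ℂ] B →ₗ[ℂ] A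
  pairing_symm : ∀ u v : B, pairing u v = pairing v u
  d : A →ₗ[ℂ] B
  π_d : ∀ a : A, π (d a) = 0
  star_star : ∀ (a a' : A) (v : B),
    star a (star a' v) - star (a * a') v = star (π v a) (d a') + star (π v a') (d a)
  bracket_star : ∀ (u v : B) (a : A), bracket u (star a v) = star (π u a) v + star a (bracket u v)
  bracket_add_bracket : ∀ u v : B, bracket u v + bracket v u = d (pairing u v)
  π_star : ∀ (a : A) (v : B), π (star a v) = a • π v
  pairing_star : ∀ (a : A) (u v : B), pairing (star a u) v = a * pairing u v - π u (π v a)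
  π_pairing : ∀ v v₁ v₂ : B,
    π v (pairing v₁ v₂) = pairing (bracket v v₁) v₂ + pairing v₁ (bracket v v₂)
  d_mul : ∀ a a' : A, d (a * a') = star a (d a') + star a' (d a)
  bracket_d : ∀ (v : B) (a : A), bracket v (d a) = d (π v a)
  pairing_d : ∀ (v : B) (a : A), pairing v (d a) = π v a

namespace VertexAlgebroid

section Construction

variable (A B : Type*) [CommRing A] [Algebra ℂ A] [AddCommGroup B] [Module ℂ B]
  [VertexAlgebroid A B]

theorem d_bracket (a : A) (v : B) : bracket A (d a : B) v = 0 := by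
  have h := bracket_add_bracket (A := A) v (d a)
  rw [bracket_d, pairing_d] at h
  exact add_eq_left.mp h

/-- The product `u_0 v` of the `1`-truncated conformal algebra `A ⊕ B`. -/
def op0 : A × B →ₗ[ℂ] A × B →ₗ[ℂ] A × B :=
  LinearMap.mk₂ ℂ (fun u v => (π u.2 v.1 - π v.2 u.1, bracket A u.2 v.2))
    (fun u u' v => by ext <;> simp; abel) (fun c u v => by ext <;> simp [smul_sub])
    (fun u v v' => by ext <;> simp; abel) (fun c u v => by ext <;> simp [smul_sub])

/-- The product `u_1 v` of the `1`-truncated conformal algebra `A ⊕ B`. -/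
def op1 : A × B →ₗ[ℂ] A × B →ₗ[ℂ] A × B :=
  LinearMap.mk₂ ℂ (fun u v => (pairing u.2 v.2, 0))
    (fun u u' v => by ext <;> simp) (fun c u v => by ext <;> simp)
    (fun u v v' => by ext <;> simp) (fun c u v => by ext <;> simp)

theorem op0_apply (u v : A × B) :
    op0 A B u v = (π u.2 v.1 - π v.2 u.1, bracket A u.2 v.2) := rfl

theorem op1_apply (u v : A × B) : op1 A B u v = (pairing u.2 v.2, 0) := rfl

/-- The loop space `L(A ⊕ B) = (A ⊕ B) ⊗ ℂ[t, t⁻¹]`; `Finsupp.single n u` is `u ⊗ t^n`. -/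
abbrev Loop : Type _ := ℤ →₀ (A × B)

/-- The product on `L(A ⊕ B)`:
`[u ⊗ t^m, v ⊗ t^n] = u_0 v ⊗ t^{m+n} + m (u_1 v ⊗ t^{m+n-1})`. -/
def loopBracket : Loop A B →ₗ[ℂ] Loop A B →ₗ[ℂ] Loop A B :=
  Finsupp.lsum ℂ fun m => (Finsupp.lsum ℂ).toLinearMap ∘ₗ LinearMap.pi fun n =>
    LinearMap.compRight ℂ (Finsupp.lsingle (m + n)) ∘ₗ op0 A B +
      m • (LinearMap.compRight ℂ (Finsupp.lsingle (m + n - 1)) ∘ₗ op1 A B)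

theorem loopBracket_single (u v : A × B) (m n : ℤ) :
    loopBracket A B (Finsupp.single m u) (Finsupp.single n v) =
      Finsupp.single (m + n) (op0 A B u v) + m • Finsupp.single (m + n - 1) (op1 A B u v) := by
  simp [loopBracket]

/-- The map `∂ ⊗ 1 + 1 ⊗ d/dt` from `L(A) = A ⊗ ℂ[t, t⁻¹]` to `L(A ⊕ B)`. -/
def dhat : (ℤ →₀ A) →ₗ[ℂ] Loop A B :=
  Finsupp.lsum ℂ fun n => Finsupp.lsingle n ∘ₗ LinearMap.inr ℂ A B ∘ₗ d +
    n • (Finsupp.lsingle (n - 1) ∘ₗ LinearMap.inl ℂ A B)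

theorem dhat_single (n : ℤ) (a : A) :
    dhat A B (Finsupp.single n a) =
      Finsupp.single n ((0, d a) : A × B) + n • Finsupp.single (n - 1) ((a, 0) : A × B) := by
  rw [dhat, Finsupp.lsum_single]
  rfl

theorem loopBracket_dhat_left (x : ℤ →₀ A) (y : Loop A B) :
    loopBracket A B (dhat A B x) y = 0 := by
  induction x using Finsupp.induction_linear with
  | zero => simp
  | add x x' hx hx' => simp [hx, hx']
  | single n a =>
    induction y using Finsupp.induction_linear with
    | zero => simp
    | add y y' hy hy' => rw [map_add, hy, hy', add_zero]
    | single m v =>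
      rw [dhat_single, map_add, map_zsmul, LinearMap.add_apply, LinearMap.smul_apply,
        loopBracket_single, loopBracket_single]
      have h1 : op0 A B (0, d a) v = 0 := by
        rw [op0_apply, π_d, d_bracket]; simp
      have h2 : op1 A B (a, 0) v = 0 := by rw [op1_apply]; simp
      have h3 : op0 A B (a, 0) v = -op1 A B (0, d a) v := by
        rw [op0_apply, op1_apply]
        simp only
        rw [pairing_symm, pairing_d]
        ext <;> simp
      rw [h1, h2, h3, show n - 1 + m = n + m - 1 by ring]
      simp

theorem loopBracket_dhat_right (x : ℤ →₀ A) (y : Loop A B) :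
    loopBracket A B y (dhat A B x) ∈ LinearMap.range (dhat A B) := by
  induction x using Finsupp.induction_linear with
  | zero => simp
  | add x x' hx hx' => rw [map_add, map_add]; exact Submodule.add_mem _ hx hx'
  | single n a =>
    induction y using Finsupp.induction_linear with
    | zero => simp
    | add y y' hy hy' => rw [map_add, LinearMap.add_apply]; exact Submodule.add_mem _ hy hy'
    | single m v =>
      refine ⟨Finsupp.single (m + n) (π v.2 a), ?_⟩
      rw [dhat_single, dhat_single, map_add, map_zsmul,
        loopBracket_single, loopBracket_single]
      have h1 : op0 A B v (0, d a) = (0, d (π v.2 a)) := by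
        rw [op0_apply]
        simp only
        rw [π_d, bracket_d]
        ext <;> simp
      have h2 : op1 A B v (a, 0) = 0 := by rw [op1_apply]; simp
      have h3 : op0 A B v (a, 0) = (π v.2 a, 0) := by rw [op0_apply]; simp
      have h4 : op1 A B v (0, d a) = (π v.2 a, 0) := by
        rw [op1_apply]
        simp only
        rw [pairing_d]
      rw [h1, h2, h3, h4, show m + (n - 1) = m + n - 1 by ring]
      rw [Finsupp.single_zero, smul_zero, add_zero]
      module

theorem loopBracket_skew (x y : Loop A B) :
    loopBracket A B x y + loopBracket A B y x ∈ LinearMap.range (dhat A B) := by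
  induction x using Finsupp.induction_linear with
  | zero => simp
  | add x x' hx hx' =>
    rw [map_add, map_add, LinearMap.add_apply, add_add_add_comm]
    exact Submodule.add_mem _ hx hx'
  | single m u =>
    induction y using Finsupp.induction_linear with
    | zero => simp
    | add y y' hy hy' =>
      rw [map_add, map_add, LinearMap.add_apply, add_add_add_comm]
      exact Submodule.add_mem _ hy hy'
    | single n v =>
      refine ⟨Finsupp.single (m + n) (pairing u.2 v.2), ?_⟩
      have h1 : op1 A B v u = op1 A B u v := by rw [op1_apply, op1_apply, pairing_symm]
      have h2 : op0 A B v u = (0, d (pairing u.2 v.2 : A)) - op0 A B u v := by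
        rw [← bracket_add_bracket (A := A) u.2 v.2, op0_apply, op0_apply]
        ext <;> simp
      rw [dhat_single, loopBracket_single, loopBracket_single, h1, h2, add_comm n m,
        show ((pairing u.2 v.2, 0) : A × B) = op1 A B u v from rfl, Finsupp.single_sub]
      module

theorem loopBracket_leibniz (x y z : Loop A B) :
    loopBracket A B x (loopBracket A B y z) =
      loopBracket A B (loopBracket A B x y) z + loopBracket A B y (loopBracket A B x z) := by
  induction x using Finsupp.induction_linear with
  | zero => simp
  | add x x' hx hx' => simp only [map_add, LinearMap.add_apply, hx, hx']; abel
  | single m u =>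
    induction y using Finsupp.induction_linear with
    | zero => simp
    | add y y' hy hy' => simp only [map_add, LinearMap.add_apply, hy, hy']; abel
    | single n v =>
      induction z using Finsupp.induction_linear with
      | zero => simp
      | add z z' hz hz' => simp only [map_add, hz, hz']; abel
      | single k w =>
        have c00 : op0 A B u (op0 A B v w) =
            op0 A B (op0 A B u v) w + op0 A B v (op0 A B u w) := by
          simp only [op0_apply, π_bracket, Derivation.commutator_apply, map_sub]
          ext
          · simp only [Prod.fst_add]; abel
          · exact leibniz _ _ _
        have c01 : op0 A B u (op1 A B v w) =
            op1 A B (op0 A B u v) w + op1 A B v (op0 A B u w) := by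
          simp only [op0_apply, op1_apply]
          ext
          · simp [π_pairing]
          · simp
        have c10 : op1 A B u (op0 A B v w) = op1 A B (op0 A B u v) w +
            op0 A B (op1 A B u v) w + op0 A B v (op1 A B u w) := by
          simp only [op0_apply, op1_apply]
          ext
          · have h := bracket_add_bracket (A := A) u.2 v.2
            have h2 := congrArg (fun b => pairing (A := A) b w.2) h
            simp only [map_add, LinearMap.add_apply] at h2
            rw [pairing_symm (d _) w.2, pairing_d] at h2
            simp only [Prod.fst_add, map_zero, Derivation.zero_apply, LinearMap.zero_apply,
              zero_sub, sub_zero, π_pairing]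
            rw [π_pairing] at h2
            linear_combination -h2
          · simp
        have c11 : op1 A B u (op1 A B v w) = 0 := by simp [op1_apply]
        have c11' : op1 A B (op1 A B u v) w = 0 := by simp [op1_apply]
        have c11'' : op1 A B v (op1 A B u w) = 0 := by simp [op1_apply]
        simp only [loopBracket_single, map_add, map_zsmul, LinearMap.add_apply,
          LinearMap.smul_apply, c00, c01, c10, c11, c11', c11'', Finsupp.single_add,
          Finsupp.single_zero, smul_zero, add_zero]
        rw [show m + (n + k) = m + n + k by ring, show n + (m + k) = m + n + k by ring,
          show m + (n + k - 1) = m + n + k - 1 by ring, show n + (m + k - 1) = m + n + k - 1 by ring,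
          show m + n - 1 + k = m + n + k - 1 by ring]
        module

/-- The Lie algebra `𝓛 = L(A ⊕ B) / (∂ ⊗ 1 + 1 ⊗ d/dt) L(A)`. -/
def LieL : Type _ := Loop A B ⧸ LinearMap.range (dhat A B)

instance : AddCommGroup (LieL A B) :=
  inferInstanceAs (AddCommGroup (Loop A B ⧸ LinearMap.range (dhat A B)))

instance : Module ℂ (LieL A B) :=
  inferInstanceAs (Module ℂ (Loop A B ⧸ LinearMap.range (dhat A B)))

/-- The projection `L(A ⊕ B) → 𝓛`. -/
def proj : Loop A B →ₗ[ℂ] LieL A B := (LinearMap.range (dhat A B)).mkQ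

variable {A B} in
theorem proj_surjective : Function.Surjective (proj A B) := Submodule.mkQ_surjective _

theorem proj_eq_zero {x : Loop A B} : proj A B x = 0 ↔ x ∈ LinearMap.range (dhat A B) :=
  Submodule.Quotient.mk_eq_zero _

/-- The bracket of `𝓛` as a bilinear map, induced by the product on `L(A ⊕ B)`. -/
def lieBracket : LieL A B →ₗ[ℂ] LieL A B →ₗ[ℂ] LieL A B :=
  (LinearMap.range (dhat A B)).liftQ
    { toFun := fun x => (LinearMap.range (dhat A B)).mapQ (LinearMap.range (dhat A B))
        (loopBracket A B x) (by rintro _ ⟨y, rfl⟩; exact loopBracket_dhat_right A B y x)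
      map_add' := fun x y => by
        apply LinearMap.ext; intro z
        obtain ⟨z, rfl⟩ := proj_surjective z
        change proj A B (loopBracket A B (x + y) z) = _
        rw [map_add]; rfl
      map_smul' := fun c x => by
        apply LinearMap.ext; intro z
        obtain ⟨z, rfl⟩ := proj_surjective z
        change proj A B (loopBracket A B (c • x) z) = _
        rw [map_smul]; rfl }
    (by
      rintro _ ⟨y, rfl⟩
      apply LinearMap.ext
      intro z
      obtain ⟨z, rfl⟩ := proj_surjective z
      have := loopBracket_dhat_left A B y z
      exact (congrArg (proj A B) this).trans (map_zero _))

theorem lieBracket_proj (x y : Loop A B) :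
    lieBracket A B (proj A B x) (proj A B y) = proj A B (loopBracket A B x y) := rfl

instance : LieRing (LieL A B) where
  bracket x y := lieBracket A B x y
  add_lie x y z := by
    change lieBracket A B (x + y) z = _
    rw [map_add]; rfl
  lie_add x y z := map_add _ y z
  lie_self x := by
    obtain ⟨x, rfl⟩ := proj_surjective x
    have h := (proj_eq_zero A B).mpr (loopBracket_skew A B x x)
    rw [map_add, ← two_smul ℂ] at h
    exact (smul_eq_zero.mp h).resolve_left two_ne_zero
  leibniz_lie x y z := by
    obtain ⟨x, rfl⟩ := proj_surjective x
    obtain ⟨y, rfl⟩ := proj_surjective y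
    obtain ⟨z, rfl⟩ := proj_surjective z
    have h := congrArg (proj A B) (loopBracket_leibniz A B x y z)
    rw [map_add] at h
    exact h

instance : LieAlgebra ℂ (LieL A B) where
  lie_smul c x y := map_smul (lieBracket A B x) c y

/-- The element `u(n)` of `𝓛`, the class of `u ⊗ t^n`. -/
def mode (u : A × B) (n : ℤ) : LieL A B := proj A B (Finsupp.single n u)

theorem mode_add (u v : A × B) (n : ℤ) : mode A B (u + v) n = mode A B u n + mode A B v n := by
  simp [mode]

theorem mode_smul (c : ℂ) (u : A × B) (n : ℤ) : mode A B (c • u) n = c • mode A B u n := by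
  rw [mode, mode, ← map_smul, Finsupp.smul_single]

theorem mode_d (a : A) (n : ℤ) : mode A B (0, d a) n = -(n • mode A B (a, 0) (n - 1)) := by
  have h := (proj_eq_zero A B).mpr ⟨Finsupp.single n a, rfl⟩
  rw [dhat_single, map_add, map_zsmul] at h
  exact eq_neg_of_add_eq_zero_left h

theorem lie_mode (u v : A × B) (m n : ℤ) : ⁅mode A B u m, mode A B v n⁆ =
    mode A B (op0 A B u v) (m + n) + m • mode A B (op1 A B u v) (m + n - 1) := by
  have h : ⁅mode A B u m, mode A B v n⁆ =
      proj A B (loopBracket A B (Finsupp.single m u) (Finsupp.single n v)) := rfl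
  rw [h, loopBracket_single, map_add, map_zsmul]
  rfl

attribute [local instance] LieRing.ofAssociativeRing

/-- The left ideal `U(𝓛) 𝓛^{≥ 0}` of `U(𝓛)`, where `𝓛^{≥ 0}` is spanned by the `u(n)`, `n ≥ 0`. -/
def annVac : Submodule (UniversalEnvelopingAlgebra ℂ (LieL A B))
    (UniversalEnvelopingAlgebra ℂ (LieL A B)) :=
  Submodule.span _ {x | ∃ (u : A × B) (n : ℤ), 0 ≤ n ∧
    x = UniversalEnvelopingAlgebra.ι ℂ (mode A B u n)}

/-- The induced module `V_𝓛 = U(𝓛) ⊗_{U(𝓛^{≥ 0})} ℂ = U(𝓛) / U(𝓛) 𝓛^{≥ 0}`. -/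
def VL : Type _ := UniversalEnvelopingAlgebra ℂ (LieL A B) ⧸ annVac A B

instance : AddCommGroup (VL A B) :=
  inferInstanceAs (AddCommGroup (UniversalEnvelopingAlgebra ℂ (LieL A B) ⧸ annVac A B))

instance : Module (UniversalEnvelopingAlgebra ℂ (LieL A B)) (VL A B) :=
  inferInstanceAs (Module _ (UniversalEnvelopingAlgebra ℂ (LieL A B) ⧸ annVac A B))

instance : Module ℂ (VL A B) :=
  inferInstanceAs (Module ℂ (UniversalEnvelopingAlgebra ℂ (LieL A B) ⧸ annVac A B))

instance : IsScalarTower ℂ (UniversalEnvelopingAlgebra ℂ (LieL A B)) (VL A B) :=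
  inferInstanceAs (IsScalarTower ℂ _ (UniversalEnvelopingAlgebra ℂ (LieL A B) ⧸ annVac A B))

namespace VL

/-- The projection `U(𝓛) → V_𝓛`. -/
def mk : UniversalEnvelopingAlgebra ℂ (LieL A B) →ₗ[UniversalEnvelopingAlgebra ℂ (LieL A B)]
    VL A B := (annVac A B).mkQ

/-- The vacuum vector, the class of `1`. -/
def vac : VL A B := mk A B 1

theorem mk_surjective : Function.Surjective (mk A B) := Submodule.mkQ_surjective _

theorem mk_eq (y : UniversalEnvelopingAlgebra ℂ (LieL A B)) : mk A B y = y • vac A B := by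
  rw [vac, ← map_smul, smul_eq_mul, mul_one]

/-- The operator `u(n)` on `V_𝓛`. -/
def g (u : A × B) (n : ℤ) : Module.End ℂ (VL A B) :=
  Algebra.lsmul ℂ ℂ (VL A B) (UniversalEnvelopingAlgebra.ι ℂ (mode A B u n))

theorem g_apply (u : A × B) (n : ℤ) (x : VL A B) :
    g A B u n x = UniversalEnvelopingAlgebra.ι ℂ (mode A B u n) • x := rfl

theorem g_add (u v : A × B) (n : ℤ) : g A B (u + v) n = g A B u n + g A B v n := by
  simp [g, mode_add]

theorem g_smul (c : ℂ) (u : A × B) (n : ℤ) : g A B (c • u) n = c • g A B u n := by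
  simp [g, mode_smul]

theorem g_d (a : A) (n : ℤ) : g A B (0, d a) n = -(n • g A B (a, 0) (n - 1)) := by
  simp [g, mode_d]

theorem g_comm (u v : A × B) (m n : ℤ) (x : VL A B) :
    g A B u m (g A B v n x) - g A B v n (g A B u m x) =
      g A B (op0 A B u v) (m + n) x + m • g A B (op1 A B u v) (m + n - 1) x := by
  have h := congrArg (UniversalEnvelopingAlgebra.ι ℂ) (lie_mode A B u v m n)
  rw [LieHom.map_lie, LieRing.of_associative_ring_bracket, map_add, map_zsmul] at h
  simp only [g_apply]
  rw [smul_smul, smul_smul, ← sub_smul, h, add_smul, smul_assoc]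

theorem g_vac (u : A × B) (n : ℤ) (hn : 0 ≤ n) : g A B u n (vac A B) = 0 := by
  rw [g_apply, ← mk_eq]
  exact (Submodule.Quotient.mk_eq_zero _).mpr (Submodule.subset_span ⟨u, n, hn, rfl⟩)

/-- A subspace stable under the modes `u(n)` is a `U(𝓛)`-submodule. -/
theorem smul_mem_of_stable (S : Submodule ℂ (VL A B))
    (hS : ∀ u n x, x ∈ S → g A B u n x ∈ S)
    (y : UniversalEnvelopingAlgebra ℂ (LieL A B)) : ∀ x ∈ S, y • x ∈ S := by
  let T : Subalgebra ℂ (UniversalEnvelopingAlgebra ℂ (LieL A B)) :=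
    { carrier := {y | ∀ x ∈ S, y • x ∈ S}
      mul_mem' := by intro a b ha hb x hx; rw [mul_smul]; exact ha _ (hb _ hx)
      add_mem' := by intro a b ha hb x hx; rw [add_smul]; exact S.add_mem (ha _ hx) (hb _ hx)
      algebraMap_mem' := by
        intro c x hx
        rw [Algebra.algebraMap_eq_smul_one, smul_assoc, one_smul]
        exact S.smul_mem c hx }
  have hι : ∀ z : LieL A B, UniversalEnvelopingAlgebra.ι ℂ z ∈ T := by
    intro z
    obtain ⟨z, rfl⟩ := proj_surjective z
    induction z using Finsupp.induction_linear with
    | zero => rw [map_zero, map_zero]; exact T.zero_mem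
    | add z z' h h' => rw [map_add, map_add]; exact T.add_mem h h'
    | single n u => intro x hx; exact hS u n x hx
  let φ : LieL A B →ₗ⁅ℂ⁆ T :=
    { toFun := fun z => ⟨UniversalEnvelopingAlgebra.ι ℂ z, hι z⟩
      map_add' := fun z z' => by ext; simp
      map_smul' := fun c z => by ext; simp
      map_lie' := by
        intro z z'
        ext
        simp [LieRing.of_associative_ring_bracket] }
  have h : T.val.comp (UniversalEnvelopingAlgebra.lift ℂ φ) = AlgHom.id ℂ _ := by
    apply UniversalEnvelopingAlgebra.hom_ext
    ext z
    simp [φ]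
  have hy := congrArg (fun f => f y) h
  simp only [AlgHom.comp_apply, AlgHom.id_apply] at hy
  exact hy ▸ (UniversalEnvelopingAlgebra.lift ℂ φ y).2

theorem ind (S : Submodule ℂ (VL A B)) (h1 : vac A B ∈ S)
    (hS : ∀ u n x, x ∈ S → g A B u n x ∈ S) (x : VL A B) : x ∈ S := by
  obtain ⟨y, rfl⟩ := mk_surjective A B x
  rw [mk_eq]
  exact smul_mem_of_stable A B S hS y _ h1

/-- The universal property of `V_𝓛`. -/
theorem exists_lift {M : Type*} [AddCommGroup M] [Module ℂ M]
    (G : A × B → ℤ → Module.End ℂ M)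
    (hadd : ∀ u v n, G (u + v) n = G u n + G v n) (hsmul : ∀ (c : ℂ) u n, G (c • u) n = c • G u n)
    (hd : ∀ a n, G (0, d a) n = -(n • G (a, 0) (n - 1)))
    (hcomm : ∀ u v m n x, G u m (G v n x) - G v n (G u m x) =
      G (op0 A B u v) (m + n) x + m • G (op1 A B u v) (m + n - 1) x)
    (m₀ : M) (h0 : ∀ u n, 0 ≤ n → G u n m₀ = 0) :
    ∃ f : VL A B →ₗ[ℂ] M, f (vac A B) = m₀ ∧ ∀ u n x, f (g A B u n x) = G u n (f x) := by
  let ρ₀ : Loop A B →ₗ[ℂ] Module.End ℂ M := Finsupp.lsum ℂ fun n =>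
    { toFun := fun u => G u n
      map_add' := fun u v => hadd u v n
      map_smul' := fun c u => hsmul c u n }
  have hρ₀ : ∀ n u, ρ₀ (Finsupp.single n u) = G u n := fun n u => by
    rw [show ρ₀ = _ from rfl, Finsupp.lsum_single]
    rfl
  let ρ₁ : LieL A B →ₗ[ℂ] Module.End ℂ M := (LinearMap.range (dhat A B)).liftQ ρ₀ (by
    rintro _ ⟨x, rfl⟩
    rw [LinearMap.mem_ker]
    induction x using Finsupp.induction_linear with
    | zero => simp
    | add x y hx hy => rw [map_add, map_add, hx, hy, add_zero]
    | single n a =>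
      rw [dhat_single, map_add, map_zsmul, hρ₀, hρ₀, hd]
      simp)
  have hρ₁ : ∀ x, ρ₁ (proj A B x) = ρ₀ x := fun x => rfl
  let ρ : LieL A B →ₗ⁅ℂ⁆ Module.End ℂ M :=
    { ρ₁ with
      map_lie' := by
        intro x y
        obtain ⟨x, rfl⟩ := proj_surjective x
        obtain ⟨y, rfl⟩ := proj_surjective y
        change ρ₀ (loopBracket A B x y) = ⁅ρ₀ x, ρ₀ y⁆
        induction x using Finsupp.induction_linear with
        | zero => simp
        | add x x' hx hx' => simp only [map_add, LinearMap.add_apply, hx, hx', add_lie]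
        | single m u =>
          induction y using Finsupp.induction_linear with
          | zero => simp
          | add y y' hy hy' => simp only [map_add, hy, hy', lie_add]
          | single n v =>
            rw [loopBracket_single, map_add, map_zsmul]
            simp only [hρ₀]
            ext x
            rw [LieRing.of_associative_ring_bracket]
            exact (hcomm u v m n x).symm }
  have hρ : ∀ u n, ρ (mode A B u n) = G u n := fun u n => hρ₀ n u
  let ψ : UniversalEnvelopingAlgebra ℂ (LieL A B) →ₐ[ℂ] Module.End ℂ M :=
    UniversalEnvelopingAlgebra.lift ℂ ρ
  have hψ : ∀ u n, ψ (UniversalEnvelopingAlgebra.ι ℂ (mode A B u n)) = G u n := fun u n => by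
    rw [UniversalEnvelopingAlgebra.lift_ι_apply, hρ]
  let f₀ : UniversalEnvelopingAlgebra ℂ (LieL A B) →ₗ[ℂ] M :=
    (LinearMap.applyₗ m₀) ∘ₗ ψ.toLinearMap
  have hker : (annVac A B).restrictScalars ℂ ≤ LinearMap.ker f₀ := by
    intro x hx
    rw [Submodule.restrictScalars_mem] at hx
    rw [LinearMap.mem_ker]
    induction hx using Submodule.span_induction with
    | mem x hx =>
      obtain ⟨u, n, hn, rfl⟩ := hx
      change ψ _ m₀ = 0
      rw [hψ, h0 u n hn]
    | zero => simp
    | add x y _ _ hx hy => rw [map_add, hx, hy, add_zero]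
    | smul c x _ hx =>
      change ψ (c * x) m₀ = 0
      rw [map_mul, Module.End.mul_apply, show ψ x m₀ = 0 from hx, map_zero]
  let f : VL A B →ₗ[ℂ] M := ((annVac A B).restrictScalars ℂ).liftQ f₀ hker ∘ₗ
    (Submodule.Quotient.restrictScalarsEquiv ℂ (annVac A B)).symm.toLinearMap
  have hf : ∀ y, f (mk A B y) = ψ y m₀ := fun y => rfl
  refine ⟨f, ?_, fun u n x => ?_⟩
  · rw [vac, hf, map_one]; rfl
  · obtain ⟨y, rfl⟩ := mk_surjective A B x
    rw [g_apply, ← map_smul, smul_eq_mul, hf, hf, map_mul, hψ]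
    rfl

theorem trunc (u : A × B) (x : VL A B) : ∃ N : ℕ, ∀ n : ℤ, N ≤ n → g A B u n x = 0 := by
  let T : Submodule ℂ (VL A B) :=
    { carrier := {x | ∀ u, ∃ N : ℕ, ∀ n : ℤ, N ≤ n → g A B u n x = 0}
      add_mem' := by
        intro a b ha hb u
        obtain ⟨N, hN⟩ := ha u
        obtain ⟨M, hM⟩ := hb u
        exact ⟨N + M, fun n hn => by
          rw [map_add, hN n (by push_cast at hn; omega), hM n (by push_cast at hn; omega), add_zero]⟩
      zero_mem' := fun v => ⟨0, fun n _ => map_zero _⟩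
      smul_mem' := by
        intro c a ha v
        obtain ⟨N, hN⟩ := ha v
        exact ⟨N, fun n hn => by rw [map_smul, hN n hn, smul_zero]⟩ }
  refine ind A B T ?_ ?_ x u
  · exact fun u => ⟨0, fun n hn => g_vac A B u n (by simpa using hn)⟩
  · intro v m x hx u
    obtain ⟨N, hN⟩ := hx u
    obtain ⟨N0, h0⟩ := hx (op0 A B u v)
    obtain ⟨N1, h1⟩ := hx (op1 A B u v)
    refine ⟨N + N0 + N1 + m.natAbs + 1, fun n hn => ?_⟩
    have h := g_comm A B u v n m x
    rw [hN n (by omega), h0 _ (by omega), h1 _ (by omega)] at h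
    simpa using h

theorem exists_D : ∃ D : Module.End ℂ (VL A B), D (vac A B) = 0 ∧
    ∀ u n x, D (g A B u n x) - g A B u n (D x) = -(n • g A B u (n - 1) x) := by
  obtain ⟨f, hf0, hf⟩ := exists_lift A B (M := VL A B × VL A B)
    (fun u n => LinearMap.prod (g A B u n ∘ₗ LinearMap.fst ℂ _ _)
      (g A B u n ∘ₗ LinearMap.snd ℂ _ _ - n • (g A B u (n - 1) ∘ₗ LinearMap.fst ℂ _ _)))
    (fun u v n => by
      apply LinearMap.ext; intro x
      ext
      · simp [g_add]
      · simp [g_add]; abel)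
    (fun c u n => by
      apply LinearMap.ext; intro x
      ext
      · simp [g_smul]
      · simp [g_smul, smul_sub, smul_comm c])
    (fun a n => by
      apply LinearMap.ext; intro x
      ext
      · simp [g_d]
      · simp [g_d]
        module)
    (fun u v m n x => by
      have h1 := g_comm A B u v m n x.1
      have h2 := g_comm A B u v m n x.2
      have h3 := g_comm A B u v (m - 1) n x.1
      have h4 := g_comm A B u v m (n - 1) x.1
      rw [show m - 1 + n = m + n - 1 by ring] at h3
      rw [show m + (n - 1) = m + n - 1 by ring] at h4
      ext
      · simpa using h1
      · change (g A B u m (g A B v n x.2 - n • g A B v (n - 1) x.1) -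
            m • g A B u (m - 1) (g A B v n x.1)) -
          (g A B v n (g A B u m x.2 - m • g A B u (m - 1) x.1) -
            n • g A B v (n - 1) (g A B u m x.1)) =
          (g A B (op0 A B u v) (m + n) x.2 - (m + n) • g A B (op0 A B u v) (m + n - 1) x.1) +
          m • (g A B (op1 A B u v) (m + n - 1) x.2 -
            (m + n - 1) • g A B (op1 A B u v) (m + n - 1 - 1) x.1)
        simp only [map_sub, map_zsmul]
        linear_combination (norm := module) h2 - m • h3 - n • h4)
    (vac A B, 0)
    (fun u n hn => by
      ext
      · simp [g_vac A B u n hn]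
      · change g A B u n 0 - n • g A B u (n - 1) (vac A B) = 0
        rw [map_zero, zero_sub, neg_eq_zero]
        rcases hn.eq_or_lt with h | h
        · rw [← h, zero_smul]
        · rw [g_vac A B u (n - 1) (by omega), smul_zero])
  have hfst : ∀ x, (f x).1 = x := by
    intro x
    let T : Submodule ℂ (VL A B) := LinearMap.eqLocus (LinearMap.fst ℂ _ _ ∘ₗ f) LinearMap.id
    refine ind A B T ?_ ?_ x
    · change (f (vac A B)).1 = vac A B
      rw [hf0]
    · intro u n x hx
      have hx : (f x).1 = x := hx
      change (f (g A B u n x)).1 = g A B u n x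
      rw [hf]
      simp [hx]
  refine ⟨LinearMap.snd ℂ _ _ ∘ₗ f, by simp [hf0], fun u n x => ?_⟩
  simp only [LinearMap.coe_comp, Function.comp_apply, hf]
  simp [hfst]

/-- The translation operator `𝓓` of `V_𝓛`: the linear operator with `𝓓 𝟏 = 0` and
`[𝓓, u(n)] = -n u(n-1)` for `u ∈ A ⊕ B`. -/
def D : Module.End ℂ (VL A B) := (exists_D A B).choose

/-- `V_𝓛` with the operators `u(n)` and `𝓓`. -/
def genSys : GenSys (A × B) (VL A B) where
  op0 u v := op0 A B u v
  op1 u v := op1 A B u v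
  g := g A B
  vac := vac A B
  D := D A B
  comm := g_comm A B
  trunc := trunc A B
  g_vac := g_vac A B
  D_g := (exists_D A B).choose_spec.2
  D_vac := (exists_D A B).choose_spec.1
  ind := ind A B

theorem exists_F : ∃ F : VL A B →ₗ[ℂ] VL A B →ₗ[ℂ] (ℤ → VL A B),
    F (vac A B) = (genSys A B).phi0 ∧
    ∀ u p w, F (g A B u p w) = (genSys A B).G u p (F w) := by
  refine exists_lift A B (genSys A B).G (fun u v p => ?_) (fun c u p => ?_) (fun a p => ?_)
    (genSys A B).G_comm _ (fun u p hp => (genSys A B).G_phi0 u p hp)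
  · apply LinearMap.ext; intro φ
    apply LinearMap.ext; intro x
    funext n
    obtain ⟨N, hN⟩ := trunc A B u x
    obtain ⟨M, hM⟩ := trunc A B v x
    simp only [LinearMap.add_apply, Pi.add_apply, GenSys.G_apply]
    simp only [genSys, g_add, LinearMap.add_apply, map_add, Pi.add_apply]
    rw [bsum_add p (N + M) (fun i hi => by rw [hN _ (by omega)]; simp)
      (fun i hi => by rw [hM _ (by omega)]; simp)]
    abel
  · apply LinearMap.ext; intro φ
    apply LinearMap.ext; intro x
    funext n
    obtain ⟨N, hN⟩ := trunc A B u x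
    simp only [LinearMap.smul_apply, Pi.smul_apply, GenSys.G_apply]
    simp only [genSys, g_smul, LinearMap.smul_apply, map_smul, Pi.smul_apply]
    have := bsum_map (DistribSMul.toAddMonoidHom (VL A B) c) p
      (f := fun i => φ (g A B u i x) (p + n - i)) N
      (fun i hi => by rw [hN _ (by omega)]; simp)
    simp only [DistribSMul.toAddMonoidHom_apply] at this
    rw [← this, smul_sub]
  · apply LinearMap.ext; intro φ
    apply LinearMap.ext; intro x
    funext n
    obtain ⟨N, hN⟩ := trunc A B (a, 0) x
    simp only [LinearMap.neg_apply, LinearMap.smul_apply, Pi.smul_apply, Pi.neg_apply,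
      GenSys.G_apply]
    simp only [genSys, g_d, LinearMap.smul_apply, LinearMap.neg_apply, map_neg, map_zsmul,
      Pi.smul_apply, Pi.neg_apply]
    have h1 := bsum_weight p (f := fun i : ℕ => φ (g A B (a, 0) (i - 1) x) (p + n - i)) (N + 1)
      (fun i hi => by rw [hN _ (by omega)]; simp)
    have h2 := bsum_smul p (-1) (f := fun i : ℕ => (i : ℤ) • φ (g A B (a, 0) (i - 1) x) (p + n - i))
      (N + 1) (fun i hi => by rw [hN _ (by omega)]; simp)
    simp only [neg_one_smul] at h2
    rw [← h2, h1, smul_sub]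
    have h3 : ∀ i : ℕ, φ (g A B (a, 0) (((i + 1 : ℕ) : ℤ) - 1) x) (p + n - ((i + 1 : ℕ) : ℤ)) =
        φ (g A B (a, 0) i x) (p - 1 + n - i) := by
      intro i
      push_cast
      rw [show (i : ℤ) + 1 - 1 = i by ring, show p + n - ((i : ℤ) + 1) = p - 1 + n - i by ring]
    simp only [h3]
    abel

/-- The state-field correspondence of `V_𝓛`. -/
def fieldSys : FieldSys (A × B) (VL A B) where
  toGenSys := genSys A B
  F := (exists_F A B).choose
  F_vac := (exists_F A B).choose_spec.1
  F_g := (exists_F A B).choose_spec.2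

/-- The vertex algebra `V_𝓛`: the vertex algebra structure on the vector space `V_𝓛` with vacuum
`𝟏` and `Y(u(-1)𝟏, x) = ∑ u(n) x^{-n-1}` for `u ∈ A ⊕ B`. -/
instance : VertexAlgebra (VL A B) := (fieldSys A B).vertexAlgebra

theorem vac_eq : (VertexAlgebra.vac : VL A B) = vac A B := rfl

theorem Y_mode (u : A × B) (n : ℤ) :
    VertexAlgebra.Y (g A B u (-1) (vac A B)) n = g A B u n :=
  LinearMap.ext fun w => (fieldSys A B).Y_gen u n w

end VL

end Construction

end VertexAlgebroid


namespace VertexAlgebroid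

section VertexAlgebraOfAlgebroid

variable (A B : Type*) [CommRing A] [Algebra ℂ A] [AddCommGroup B] [Module ℂ B]
  [VertexAlgebroid A B]

/-- The spanning vectors of the subspace `E` of `V_𝓛`, where `e` is the identity of `A` and `A ⊕ B`
is identified with a subspace of `V_𝓛` through `u ↦ u(-1)𝟏`:
`e - 𝟏`, `a(-1)a' - aa'` and `a(-1)b - a * b`. -/
inductive EGen : VL A B → Prop
  | one : EGen (VL.g A B (1, 0) (-1) (VL.vac A B) - VL.vac A B)
  | mul (a a' : A) : EGen (VL.g A B (a, 0) (-1) (VL.g A B (a', 0) (-1) (VL.vac A B)) -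
      VL.g A B (a * a', 0) (-1) (VL.vac A B))
  | star (a : A) (b : B) : EGen (VL.g A B (a, 0) (-1) (VL.g A B (0, b) (-1) (VL.vac A B)) -
      VL.g A B (0, VertexAlgebroid.star a b) (-1) (VL.vac A B))

/-- The subspace `I_B = U(𝓛) ℂ[𝓓] E` of `V_𝓛`. -/
def IB : Submodule ℂ (VL A B) :=
  (Submodule.span (UniversalEnvelopingAlgebra ℂ (LieL A B))
    {x | ∃ (k : ℕ) (e : VL A B), EGen A B e ∧ x = (VL.D A B ^ k) e}).restrictScalars ℂ

theorem g_mem_IB (u : A × B) (n : ℤ) (x : VL A B) (hx : x ∈ IB A B) :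
    VL.g A B u n x ∈ IB A B :=
  Submodule.smul_mem (Submodule.span _ _) _ hx

theorem D_mem_IB (x : VL A B) (hx : x ∈ IB A B) : VL.D A B x ∈ IB A B := by
  let S : Submodule ℂ (VL A B) := IB A B ⊓ (IB A B).comap (VL.D A B)
  have hS : ∀ u n x, x ∈ S → VL.g A B u n x ∈ S := by
    rintro u n x ⟨h1, h2⟩
    refine ⟨g_mem_IB A B u n x h1, ?_⟩
    have h := (VL.genSys A B).D_g u n x
    change VL.D A B (VL.g A B u n x) - VL.g A B u n (VL.D A B x) =
      -(n • VL.g A B u (n - 1) x) at h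
    change VL.D A B (VL.g A B u n x) ∈ IB A B
    rw [sub_eq_iff_eq_add.mp h]
    exact (IB A B).add_mem ((IB A B).neg_mem ((IB A B).toAddSubgroup.zsmul_mem
      (g_mem_IB A B u (n - 1) x h1) n)) (g_mem_IB A B u n _ h2)
  suffices h : x ∈ S from h.2
  have hx' : x ∈ Submodule.span (UniversalEnvelopingAlgebra ℂ (LieL A B))
    {x | ∃ (k : ℕ) (e : VL A B), EGen A B e ∧ x = (VL.D A B ^ k) e} := hx
  clear hx
  induction hx' using Submodule.span_induction with
  | mem x h =>
    obtain ⟨k, e, he, rfl⟩ := h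
    refine ⟨Submodule.subset_span ⟨k, e, he, rfl⟩, ?_⟩
    change VL.D A B ((VL.D A B ^ k) e) ∈ IB A B
    rw [← Module.End.mul_apply, ← pow_succ']
    exact Submodule.subset_span ⟨k + 1, e, he, rfl⟩
  | zero => exact S.zero_mem
  | add x y _ _ hx hy => exact S.add_mem hx hy
  | smul c x _ hx => exact VL.smul_mem_of_stable A B S hS c x hx

/-- The vertex algebra `V_B = V_𝓛 / I_B`. -/
def VB : Type _ := VL A B ⧸ IB A B

instance : AddCommGroup (VB A B) := inferInstanceAs (AddCommGroup (VL A B ⧸ IB A B))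

instance : Module ℂ (VB A B) := inferInstanceAs (Module ℂ (VL A B ⧸ IB A B))

instance : VertexAlgebra (VB A B) :=
  VertexAlgebra.quotient (inferInstanceAs (VertexAlgebra (VL A B))) (IB A B)
    (fun v n x hx => (VL.fieldSys A B).left_ideal (IB A B) (g_mem_IB A B) v n x hx)
    (fun v n x hx => (VL.fieldSys A B).right_ideal (IB A B) (g_mem_IB A B) (D_mem_IB A B) v n x hx)

/-- The projection `V_𝓛 → V_B`. -/
def toVB : VL A B →ₗ[ℂ] VB A B := (IB A B).mkQ

theorem toVB_vac : toVB A B VertexAlgebra.vac = VertexAlgebra.vac := rfl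

theorem toVB_Y (u v : VL A B) (n : ℤ) :
    VertexAlgebra.Y (toVB A B u) n (toVB A B v) = toVB A B (VertexAlgebra.Y u n v) := rfl

variable {A} in
/-- The image `a(-1)𝟏` of `a ∈ A` in `V_B`. -/
def ofA (a : A) : VB A B := toVB A B (VL.g A B (a, 0) (-1) (VL.vac A B))

variable {B} in
/-- The image `b(-1)𝟏` of `b ∈ B` in `V_B`. -/
def ofB (b : B) : VB A B := toVB A B (VL.g A B (0, b) (-1) (VL.vac A B))

/-- `VL.Monomial n x` says that `x` is a product of operators `a(m)` (of degree `-m-1`) and `b(m)`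
(of degree `-m`), of total degree `n`, applied to `𝟏`. -/
inductive VL.Monomial : ℤ → VL A B → Prop
  | vac : VL.Monomial 0 (VL.vac A B)
  | ofA (a : A) (m n : ℤ) (x : VL A B) : VL.Monomial n x →
      VL.Monomial (n - m - 1) (VL.g A B (a, 0) m x)
  | ofB (b : B) (m n : ℤ) (x : VL A B) : VL.Monomial n x →
      VL.Monomial (n - m) (VL.g A B (0, b) m x)

/-- The homogeneous subspace `(V_B)_(n)`, which is zero for `n < 0`. -/
def VB.weight (n : ℤ) : Submodule ℂ (VB A B) :=
  (Submodule.span ℂ {x | VL.Monomial A B n x}).map (toVB A B)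

end VertexAlgebraOfAlgebroid

section LieAlgebroid

variable (A B : Type*) [CommRing A] [Algebra ℂ A] [AddCommGroup B] [Module ℂ B]
  [VertexAlgebroid A B]

/-- The subspace `A∂A` of `B`, spanned by the elements `a * ∂a'`. -/
def AdA : Submodule ℂ B := Submodule.span ℂ {b | ∃ a a' : A, b = star a (d a')}

theorem star_d_mem (a a' : A) : star a (d a') ∈ AdA A B := Submodule.subset_span ⟨a, a', rfl⟩

theorem d_mem (a : A) : d a ∈ AdA A B := by
  rw [← one_star (A := A) (d a)]
  exact star_d_mem A B 1 a

theorem AdA_induction {p : B → Prop} (h0 : p 0) (hadd : ∀ x y, p x → p y → p (x + y))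
    (hsmul : ∀ (c : ℂ) x, p x → p (c • x)) (h : ∀ a a' : A, p (star a (d a'))) :
    ∀ b ∈ AdA A B, p b := by
  intro b hb
  induction hb using Submodule.span_induction with
  | mem x hx => obtain ⟨a, a', rfl⟩ := hx; exact h a a'
  | zero => exact h0
  | add x y _ _ hx hy => exact hadd x y hx hy
  | smul c x _ hx => exact hsmul c x hx

theorem star_mem (a : A) : ∀ b ∈ AdA A B, star a b ∈ AdA A B := by
  refine AdA_induction A B (by simp) (fun x y hx hy => ?_) (fun c x hx => ?_) (fun a' a'' => ?_)
  · rw [map_add]; exact Submodule.add_mem _ hx hy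
  · rw [map_smul]; exact Submodule.smul_mem _ c hx
  · have h := star_star a a' (d a'' : B)
    rw [π_d] at h
    simp only [Derivation.zero_apply, map_zero, LinearMap.zero_apply, add_zero] at h
    rw [sub_eq_zero.mp h]
    exact star_d_mem A B _ _

theorem bracket_mem (u : B) : ∀ b ∈ AdA A B, bracket A u b ∈ AdA A B := by
  refine AdA_induction A B (by simp) (fun x y hx hy => ?_) (fun c x hx => ?_) (fun a' a'' => ?_)
  · rw [map_add]; exact Submodule.add_mem _ hx hy
  · rw [map_smul]; exact Submodule.smul_mem _ c hx
  · rw [bracket_star, bracket_d]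
    exact Submodule.add_mem _ (star_d_mem A B _ _) (star_d_mem A B _ _)

theorem bracket_mem' (u : B) (b : B) (hb : b ∈ AdA A B) : bracket A b u ∈ AdA A B := by
  rw [eq_sub_of_add_eq (bracket_add_bracket (A := A) b u)]
  exact Submodule.sub_mem _ (d_mem A B _) (bracket_mem A B u b hb)

theorem π_mem : ∀ b ∈ AdA A B, π (A := A) b = 0 := by
  refine AdA_induction A B (by simp) (fun x y hx hy => ?_) (fun c x hx => ?_) (fun a' a'' => ?_)
  · rw [map_add, hx, hy, add_zero]
  · rw [map_smul, hx, smul_zero]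
  · rw [π_star, π_d, smul_zero]

/-- The Lie `A`-algebroid `B / A∂A`. -/
def LieAlgd : Type _ := B ⧸ AdA A B

namespace LieAlgd

instance : AddCommGroup (LieAlgd A B) := inferInstanceAs (AddCommGroup (B ⧸ AdA A B))

instance : Module ℂ (LieAlgd A B) := inferInstanceAs (Module ℂ (B ⧸ AdA A B))

/-- The projection `B → B / A∂A`. -/
def mk : B →ₗ[ℂ] LieAlgd A B := (AdA A B).mkQ

theorem mk_surjective : Function.Surjective (mk A B) := Submodule.mkQ_surjective _

theorem mk_eq_zero (b : B) : mk A B b = 0 ↔ b ∈ AdA A B := Submodule.Quotient.mk_eq_zero _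

theorem mk_eq (b b' : B) : mk A B b = mk A B b' ↔ b - b' ∈ AdA A B := by
  rw [← sub_eq_zero, ← map_sub, mk_eq_zero]

instance : SMul A (LieAlgd A B) :=
  ⟨fun a => (AdA A B).mapQ (AdA A B) (star a) (star_mem A B a)⟩

theorem smul_mk (a : A) (b : B) : a • mk A B b = mk A B (star a b) := rfl

instance : Module A (LieAlgd A B) where
  one_smul x := by
    obtain ⟨b, rfl⟩ := mk_surjective A B x
    rw [smul_mk, one_star]
  mul_smul a a' x := by
    obtain ⟨b, rfl⟩ := mk_surjective A B x
    rw [smul_mk, smul_mk, smul_mk, eq_comm, mk_eq, star_star]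
    exact Submodule.add_mem _ (star_d_mem A B _ _) (star_d_mem A B _ _)
  smul_zero a := map_zero ((AdA A B).mapQ (AdA A B) (star a) (star_mem A B a))
  smul_add a := map_add ((AdA A B).mapQ (AdA A B) (star a) (star_mem A B a))
  add_smul a a' x := by
    obtain ⟨b, rfl⟩ := mk_surjective A B x
    rw [smul_mk, smul_mk, smul_mk, map_add, LinearMap.add_apply, map_add]
  zero_smul x := by
    obtain ⟨b, rfl⟩ := mk_surjective A B x
    rw [smul_mk, map_zero, LinearMap.zero_apply, map_zero]

instance : IsScalarTower ℂ A (LieAlgd A B) where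
  smul_assoc c a x := by
    obtain ⟨b, rfl⟩ := mk_surjective A B x
    rw [smul_mk, smul_mk, map_smul, LinearMap.smul_apply, map_smul]

/-- The bracket of `B / A∂A` as a bilinear map. -/
def bracketₗ : LieAlgd A B →ₗ[ℂ] LieAlgd A B →ₗ[ℂ] LieAlgd A B :=
  (AdA A B).liftQ
    { toFun := fun u => (AdA A B).mapQ (AdA A B) (bracket A u) (bracket_mem A B u)
      map_add' := fun u v => by
        apply LinearMap.ext; intro w
        obtain ⟨w, rfl⟩ := mk_surjective A B w
        change mk A B (bracket A (u + v) w) = _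
        rw [map_add]; rfl
      map_smul' := fun c u => by
        apply LinearMap.ext; intro w
        obtain ⟨w, rfl⟩ := mk_surjective A B w
        change mk A B (bracket A (c • u) w) = _
        rw [map_smul]; rfl }
    (by
      intro u hu
      apply LinearMap.ext; intro w
      obtain ⟨w, rfl⟩ := mk_surjective A B w
      exact (mk_eq_zero A B _).mpr (bracket_mem' A B w u hu))

instance : LieRing (LieAlgd A B) where
  bracket x y := bracketₗ A B x y
  add_lie x y z := by
    change bracketₗ A B (x + y) z = _
    rw [map_add]; rfl
  lie_add x y z := map_add _ y z
  lie_self x := by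
    obtain ⟨x, rfl⟩ := mk_surjective A B x
    have h : mk A B (bracket A x x + bracket A x x) = 0 := by
      rw [mk_eq_zero, bracket_add_bracket]
      exact d_mem A B _
    rw [map_add, ← two_smul ℂ] at h
    exact (smul_eq_zero.mp h).resolve_left two_ne_zero
  leibniz_lie x y z := by
    obtain ⟨x, rfl⟩ := mk_surjective A B x
    obtain ⟨y, rfl⟩ := mk_surjective A B y
    obtain ⟨z, rfl⟩ := mk_surjective A B z
    have h := congrArg (mk A B) (leibniz (A := A) x y z)
    rw [map_add] at h
    exact h

theorem lie_mk (u v : B) : ⁅mk A B u, mk A B v⁆ = mk A B (bracket A u v) := rfl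

instance : LieAlgebra ℂ (LieAlgd A B) where
  lie_smul c x y := map_smul (bracketₗ A B x) c y

/-- The action of `B / A∂A` on `A` by derivations. -/
def anchor : LieAlgd A B →ₗ[ℂ] Derivation ℂ A A := (AdA A B).liftQ π (π_mem A B)

theorem anchor_mk (b : B) : anchor A B (mk A B b) = π b := rfl

instance : LieRingModule (LieAlgd A B) A where
  bracket x a := anchor A B x a
  add_lie x y a := by
    change anchor A B (x + y) a = _
    rw [map_add]; rfl
  lie_add x a a' := map_add (anchor A B x) a a'
  leibniz_lie x y a := by
    obtain ⟨x, rfl⟩ := mk_surjective A B x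
    obtain ⟨y, rfl⟩ := mk_surjective A B y
    change π x (π y a) = π (bracket A x y) a + π y (π x a)
    rw [π_bracket, Derivation.commutator_apply, sub_add_cancel]

theorem mk_lie (b : B) (a : A) : ⁅mk A B b, a⁆ = π b a := rfl

instance : LieRinehartRing A (LieAlgd A B) where
  lie_smul_eq_mul' a b x := by
    obtain ⟨x, rfl⟩ := mk_surjective A B x
    rw [smul_mk, mk_lie, mk_lie, π_star]
    rfl
  leibniz_mul_right' x a b := by
    obtain ⟨x, rfl⟩ := mk_surjective A B x
    rw [mk_lie, mk_lie, mk_lie, Derivation.leibniz, smul_eq_mul, smul_eq_mul, mul_comm b]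
  leibniz_smul_right' x y a := by
    obtain ⟨x, rfl⟩ := mk_surjective A B x
    obtain ⟨y, rfl⟩ := mk_surjective A B y
    rw [smul_mk, lie_mk, lie_mk, mk_lie, smul_mk, smul_mk, bracket_star, map_add, add_comm]

instance : LieRinehartAlgebra ℂ A (LieAlgd A B) where
  smul_lie c x a := by
    change anchor A B (c • x) a = _
    rw [map_smul]; rfl
  lie_smul c x a := (anchor A B x).map_smul c a

end LieAlgd

end LieAlgebroid

end VertexAlgebroid

/-- A module structure on the vector space `W` for a Lie `A`-algebroid `L` (a Lie-Rinehart algebra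
over `A`): an `A`-module structure and an `L`-module structure with `u(aw) - a(uw) = (ua)w` and
`a(uw) = (au)w`. -/
structure LieAlgebroidModule (A L W : Type*) [CommRing A] [Algebra ℂ A] [LieRing L]
    [LieAlgebra ℂ L] [Module A L] [LieRingModule L A] [LieRinehartRing A L]
    [LieRinehartAlgebra ℂ A L] [AddCommGroup W] [Module ℂ W] where
  smul : A →ₐ[ℂ] Module.End ℂ W
  act : L →ₗ[ℂ] Module.End ℂ W
  act_lie : ∀ (u v : L) (w : W), act ⁅u, v⁆ w = act u (act v w) - act v (act u w)
  act_smul : ∀ (u : L) (a : A) (w : W), act u (smul a w) - smul a (act u w) = smul ⁅u, a⁆ w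
  smul_act : ∀ (a : A) (u : L) (w : W), smul a (act u w) = act (a • u) w

/-- A module for a Lie `A`-algebroid is simple if it is nonzero and has no subspaces stable under
`A` and `L` except `0` and the whole module. -/
def LieAlgebroidModule.IsSimple {A L W : Type*} [CommRing A] [Algebra ℂ A] [LieRing L]
    [LieAlgebra ℂ L] [Module A L] [LieRingModule L A] [LieRinehartRing A L]
    [LieRinehartAlgebra ℂ A L] [AddCommGroup W] [Module ℂ W]
    (𝓜 : LieAlgebroidModule A L W) : Prop :=
  Nontrivial W ∧ ∀ N : Submodule ℂ W, (∀ a, ∀ w ∈ N, 𝓜.smul a w ∈ N) →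
    (∀ u, ∀ w ∈ N, 𝓜.act u w ∈ N) → N = ⊥ ∨ N = ⊤

namespace VertexAlgebroid

section GradedModule

variable (A B : Type*) [CommRing A] [Algebra ℂ A] [AddCommGroup B] [Module ℂ B]
  [VertexAlgebroid A B] {M : Type*} [AddCommGroup M] [Module ℂ M] [VertexModule (VB A B) M]

/-- `M = ∐_{n ∈ ℕ} W(n)` is an `ℕ`-graded `V_B`-module: for `v ∈ (V_B)_(k)`, the operator `v_m` maps
`W(n)` to `W(k + n - m - 1)`, where `W(j) = 0` for `j < 0`. -/
structure IsNGraded (W : ℕ → Submodule ℂ M) : Prop where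
  isInternal : DirectSum.IsInternal W
  mode_mem : ∀ (k m : ℤ) (n j : ℕ), ∀ v ∈ VB.weight A B k, ∀ w ∈ W n,
    (j : ℤ) = k + n - m - 1 → VertexModule.Y v m w ∈ W j
  mode_eq_zero : ∀ (k m : ℤ) (n : ℕ), ∀ v ∈ VB.weight A B k, ∀ w ∈ W n,
    k + n - m - 1 < 0 → VertexModule.Y v m w = 0

/-- The `ℕ`-graded `V_B`-module `M = ∐ W(n)` is graded simple: it is nonzero and its only graded
`V_B`-submodules are `0` and `M`. -/
def IsGradedSimple (W : ℕ → Submodule ℂ M) : Prop :=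
  Nontrivial M ∧ ∀ N : Submodule ℂ M,
    (∀ (v : VB A B) (n : ℤ), ∀ w ∈ N, VertexModule.Y v n w ∈ N) →
    N = ⨆ n, N ⊓ W n → N = ⊥ ∨ N = ⊤

end GradedModule

end VertexAlgebroid

end

/-!
On `W(0)` the operators `a_n` (`n ≥ 0`) and `b_n` (`n ≥ 1`) vanish for degree reasons, so the
commutator and iterate formulas lose all their correction terms there and turn into the axioms of a
module over the Lie algebroid `B / A∂A`.

For simplicity, let `N ⊆ W(0)` be stable under all `a_{-1}` and `b_0`, and let `C` be the smallest
subspace that contains `N` and is stable under the degree-raising operators `a_n` (`n ≤ -2`) and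
`b_n` (`n ≤ -1`). Let `u` range over `A ⊕ B`: moving an operator `u_m` to the right past a raising
operator only produces further operators of the form `u_m`, so `C` is stable under all `u_m`, hence
is a graded `V_B`-submodule. Raising operators never land in degree `0`, so `C ∩ W(0) = N`; thus
`C = 0` or `C = W` forces `N = 0` or `N = W(0)`.
-/

section StableClosure

variable {R M : Type*} [CommRing R] [AddCommGroup M] [Module R M]

/-- The smallest subspace that contains `N` and is stable under all operators in `T`. -/
def stableClosure (T : Set (Module.End R M)) (N : Submodule R M) : Submodule R M :=
  sInf {S | N ≤ S ∧ ∀ t ∈ T, ∀ x ∈ S, t x ∈ S}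

variable {T : Set (Module.End R M)} {N : Submodule R M}

theorem le_stableClosure : N ≤ stableClosure T N := le_sInf fun _ hS => hS.1

theorem apply_mem_stableClosure {t : Module.End R M} (ht : t ∈ T) {x : M}
    (hx : x ∈ stableClosure T N) : t x ∈ stableClosure T N := by
  rw [stableClosure, Submodule.mem_sInf] at hx ⊢
  exact fun S hS => hS.2 t ht x (hx S hS)

theorem stableClosure_le {S : Submodule R M} (hN : N ≤ S) (hS : ∀ t ∈ T, ∀ x ∈ S, t x ∈ S) :
    stableClosure T N ≤ S := sInf_le ⟨hN, hS⟩

theorem apply_mem_stableClosure_of_commutator {F : Set (Module.End R M)}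
    (hcomm : ∀ f ∈ F, ∀ t ∈ T, f * t - t * f ∈ Submodule.span R F)
    (hN : ∀ f ∈ F, ∀ x ∈ N, f x ∈ stableClosure T N) {f : Module.End R M} (hf : f ∈ F) {x : M}
    (hx : x ∈ stableClosure T N) : f x ∈ stableClosure T N := by
  let C := stableClosure T N
  let K : Submodule R M := C ⊓ ⨅ f ∈ F, C.comap f
  have mem_K {x : M} : x ∈ K ↔ x ∈ C ∧ ∀ f ∈ F, f x ∈ C := by simp [K, Submodule.mem_iInf]
  suffices hK : C ≤ K from (mem_K.mp (hK hx)).2 f hf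
  refine stableClosure_le (fun x hx => mem_K.mpr ⟨le_stableClosure hx, fun f hf => hN f hf x hx⟩)
    fun t ht x hx => ?_
  obtain ⟨hxC, hxF⟩ := mem_K.mp hx
  refine mem_K.mpr ⟨apply_mem_stableClosure ht hxC, fun f hf => ?_⟩
  have hspan : Submodule.span R F ≤ C.comap (LinearMap.applyₗ x) := Submodule.span_le.mpr hxF
  have hbracket : f (t x) - t (f x) ∈ C := hspan (hcomm f hf t ht)
  exact sub_add_cancel (f (t x)) _ ▸ add_mem hbracket (apply_mem_stableClosure ht (hxF f hf))

variable {ι : Type*} {W : ι → Submodule R M} {i : ι}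

theorem stableClosure_eq_iSup_inf (hT : ∀ t ∈ T, ∀ k, ∃ j, ∀ w ∈ W k, t w ∈ W j) (hN : N ≤ W i) :
    stableClosure T N = ⨆ k, stableClosure T N ⊓ W k := by
  refine le_antisymm (stableClosure_le ?_ fun t ht x hx => ?_) (iSup_le fun _ => inf_le_left)
  · exact (le_inf le_stableClosure hN).trans (le_iSup (fun k => stableClosure T N ⊓ W k) i)
  · induction hx using Submodule.iSup_induction' with
    | mem k w hw =>
      obtain ⟨j, hj⟩ := hT t ht k
      exact Submodule.mem_iSup_of_mem j ⟨apply_mem_stableClosure ht hw.1, hj w hw.2⟩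
    | zero => rw [map_zero]; exact zero_mem _
    | add x y _ _ hx hy => rw [map_add]; exact add_mem hx hy

theorem apply_mem_iSup_ne {t : Module.End R M} (htop : ⨆ k, W k = ⊤)
    (ht : ∀ k, ∃ j ≠ i, ∀ w ∈ W k, t w ∈ W j) (x : M) : t x ∈ ⨆ (j) (_ : j ≠ i), W j := by
  have hx : x ∈ ⨆ k, W k := htop ▸ Submodule.mem_top
  induction hx using Submodule.iSup_induction' with
  | mem k w hw =>
    obtain ⟨j, hji, hj⟩ := ht k
    exact Submodule.mem_iSup_of_mem j (Submodule.mem_iSup_of_mem hji (hj w hw))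
  | zero => rw [map_zero]; exact zero_mem _
  | add x y _ _ hx hy => rw [map_add]; exact add_mem hx hy

theorem stableClosure_inf_eq (hind : iSupIndep W) (htop : ⨆ k, W k = ⊤)
    (hT : ∀ t ∈ T, ∀ k, ∃ j ≠ i, ∀ w ∈ W k, t w ∈ W j) (hN : N ≤ W i) :
    stableClosure T N ⊓ W i = N := by
  refine le_antisymm ?_ (le_inf le_stableClosure hN)
  have hle : stableClosure T N ≤ N ⊔ ⨆ (j) (_ : j ≠ i), W j :=
    stableClosure_le le_sup_left fun t ht x _ =>
      Submodule.mem_sup_right (apply_mem_iSup_ne htop (hT t ht) x)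
  calc stableClosure T N ⊓ W i ≤ (N ⊔ ⨆ (j) (_ : j ≠ i), W j) ⊓ W i := inf_le_inf_right _ hle
    _ = N ⊔ (⨆ (j) (_ : j ≠ i), W j) ⊓ W i := sup_inf_assoc_of_le _ hN
    _ = N := by rw [(hind i).symm.eq_bot, sup_bot_eq]

end StableClosure

/-- A linear family of operators on `M`, restricted to a subspace stable under all of them. -/
def restrictEnd {R L M : Type*} [CommRing R] [AddCommGroup L] [Module R L] [AddCommGroup M]
    [Module R M] (f : L →ₗ[R] Module.End R M) (P : Submodule R M)
    (hf : ∀ x, ∀ w ∈ P, f x w ∈ P) : L →ₗ[R] Module.End R P where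
  toFun x := (f x).restrict (hf x)
  map_add' x y := by ext; simp
  map_smul' c x := by ext; simp

namespace VertexModule

variable {V : Type*} [AddCommGroup V] [Module ℂ V] [VertexAlgebra V]
  {W : Type*} [AddCommGroup W] [Module ℂ W] [VertexModule V W]

theorem commutator_formula (u v : V) (m n : ℤ) (w : W) :
    Y u m (Y v n w) - Y v n (Y u m w) =
      bsum m fun i => Y (VertexAlgebra.Y u i v) (m + n - i) w := by
  have h := VertexModule.jacobi (V := V) u v w 0 m n
  rw [finsum_eq_single _ 0 fun i hi => by
    rw [Ring.choose_zero_pos ℤ (Nat.pos_of_ne_zero hi), mul_zero, zero_smul]] at h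
  simpa [bsum] using h

theorem iterate_formula (u v : V) (l n : ℤ) (w : W) :
    Y (VertexAlgebra.Y u l v) n w =
      ∑ᶠ i : ℕ, ((-1) ^ i * Ring.choose l i) • (Y u (l - i) (Y v (n + i) w) -
        (l.negOnePow : ℤ) • Y v (n + l - i) (Y u i w)) := by
  have h := VertexModule.jacobi (V := V) u v w l 0 n
  rw [show (∑ᶠ i : ℕ, Ring.choose (0 : ℤ) i • Y (VertexAlgebra.Y u (l + i) v) (0 + n - i) w) = _
    from bsum_zero_left _] at h
  simpa using h.symm

theorem Y_neg_one_apply_of_eq_zero {u v : V} {n : ℤ} {w : W} (hu : ∀ i, 0 ≤ i → Y u i w = 0)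
    (hv : ∀ i, n < i → Y v i w = 0) :
    Y (VertexAlgebra.Y u (-1) v) n w = Y u (-1) (Y v n w) := by
  rw [iterate_formula, finsum_eq_single _ 0 fun i hi => by
    rw [hv (n + i) (by omega), hu i (by omega)]; simp]
  simp [hu 0 le_rfl]

theorem Y_translate_zero (v : V) (w : W) :
    Y (VertexAlgebra.Y v (-2) VertexAlgebra.vac) 0 w = 0 := by
  rw [iterate_formula]
  refine finsum_eq_zero_of_forall_eq_zero fun i => ?_
  rw [vac_left, vac_left, if_neg (by omega), if_neg (by omega), map_zero, smul_zero, sub_zero,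
    smul_zero]

/-- The vectors of `V` all of whose modes preserve the subspace `Q` of the module. -/
def modeStabilizer (V : Type*) [AddCommGroup V] [Module ℂ V] [VertexAlgebra V] [VertexModule V W]
    (Q : Submodule ℂ W) : Submodule ℂ V where
  carrier := {v | ∀ n, ∀ x ∈ Q, Y v n x ∈ Q}
  add_mem' {v v'} hv hv' n x hx := by
    rw [map_add, Pi.add_apply, LinearMap.add_apply]
    exact Q.add_mem (hv n x hx) (hv' n x hx)
  zero_mem' n x _ := by
    rw [map_zero, Pi.zero_apply, LinearMap.zero_apply]
    exact Q.zero_mem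
  smul_mem' c v hv n x hx := by
    rw [map_smul, Pi.smul_apply, LinearMap.smul_apply]
    exact Q.smul_mem c (hv n x hx)

theorem vac_mem_modeStabilizer (Q : Submodule ℂ W) :
    VertexAlgebra.vac ∈ modeStabilizer V Q := by
  intro n x hx
  rw [vac_left]
  split_ifs
  exacts [hx, Q.zero_mem]

theorem Y_mem_modeStabilizer {Q : Submodule ℂ W} {u v : V} (hu : u ∈ modeStabilizer V Q)
    (hv : v ∈ modeStabilizer V Q) (l : ℤ) : VertexAlgebra.Y u l v ∈ modeStabilizer V Q := by
  intro n x hx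
  rw [iterate_formula]
  refine finsum_induction (· ∈ Q) Q.zero_mem (fun _ _ => Q.add_mem) fun i => zsmul_mem ?_ _
  exact Q.sub_mem (hu _ _ (hv _ _ hx)) (zsmul_mem (hv _ _ (hu _ _ hx)) _)

end VertexModule

namespace VertexAlgebroid

open VertexModule

section Generators

variable (A B : Type*) [CommRing A] [Algebra ℂ A] [AddCommGroup B] [Module ℂ B]
  [VertexAlgebroid A B]

/-- The identification `u ↦ u(-1)𝟏` of `A ⊕ B` with a space of vectors of `V_B`; it is `ofA` on `A`
and `ofB` on `B`. -/
noncomputable def ofProd : A × B →ₗ[ℂ] VB A B where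
  toFun u := toVB A B (VL.g A B u (-1) (VL.vac A B))
  map_add' u v := by rw [VL.g_add, LinearMap.add_apply, map_add]
  map_smul' c u := by rw [VL.g_smul, LinearMap.smul_apply, map_smul, RingHom.id_apply]

variable {A B}

theorem ofProd_eq (u : A × B) : ofProd A B u = ofA B u.1 + ofB A u.2 := by
  change _ = ofProd A B (u.1, 0) + ofProd A B (0, u.2)
  rw [← map_add, Prod.fst_add_snd]

theorem Y_ofProd_toVB (u : A × B) (n : ℤ) (x : VL A B) :
    VertexAlgebra.Y (ofProd A B u) n (toVB A B x) = toVB A B (VL.g A B u n x) := by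
  rw [← VL.Y_mode]
  exact toVB_Y A B _ _ _

theorem VB.eq_top_of_stable {S : Submodule ℂ (VB A B)} (hvac : VertexAlgebra.vac ∈ S)
    (hS : ∀ u n, ∀ x ∈ S, VertexAlgebra.Y (ofProd A B u) n x ∈ S) : S = ⊤ := by
  refine eq_top_iff.mpr fun v _ => ?_
  obtain ⟨x, rfl⟩ := Submodule.mkQ_surjective _ v
  refine VL.ind A B (S.comap (toVB A B)) hvac (fun u n y hy => ?_) x
  rw [Submodule.mem_comap, ← Y_ofProd_toVB]
  exact hS u n _ hy

theorem Y_ofProd_ofProd (u v : A × B) {n : ℤ} (hn : 0 ≤ n) :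
    VertexAlgebra.Y (ofProd A B u) n (ofProd A B v) =
      toVB A B (VL.g A B (op0 A B u v) (n + -1) (VL.vac A B) +
        n • VL.g A B (op1 A B u v) (n + -1 - 1) (VL.vac A B)) := by
  refine (Y_ofProd_toVB u n _).trans (congrArg (toVB A B) ?_)
  have h := VL.g_comm A B u v n (-1) (VL.vac A B)
  rwa [VL.g_vac A B u n hn, map_zero, sub_zero] at h

theorem Y_ofProd_zero (u v : A × B) :
    VertexAlgebra.Y (ofProd A B u) 0 (ofProd A B v) = ofProd A B (op0 A B u v) := by
  rw [Y_ofProd_ofProd u v le_rfl, zero_smul, add_zero]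
  rfl

theorem Y_ofProd_one (u v : A × B) :
    VertexAlgebra.Y (ofProd A B u) 1 (ofProd A B v) = ofProd A B (op1 A B u v) := by
  rw [Y_ofProd_ofProd u v zero_le_one, VL.g_vac A B _ (1 + -1) le_rfl, zero_add, one_smul]
  rfl

theorem Y_ofProd_of_two_le (u v : A × B) {n : ℤ} (hn : 2 ≤ n) :
    VertexAlgebra.Y (ofProd A B u) n (ofProd A B v) = 0 := by
  rw [Y_ofProd_ofProd u v (by omega), VL.g_vac A B _ (n + -1) (by omega),
    VL.g_vac A B _ (n + -1 - 1) (by omega), smul_zero, add_zero, map_zero]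

theorem toVB_eq_of_EGen {x y : VL A B} (h : EGen A B (x - y)) : toVB A B x = toVB A B y :=
  (Submodule.Quotient.eq (IB A B)).mpr (Submodule.subset_span ⟨0, _, h, rfl⟩)

theorem ofA_one : ofA B (1 : A) = (VertexAlgebra.vac : VB A B) := toVB_eq_of_EGen .one

theorem Y_ofA_ofA (a a' : A) : VertexAlgebra.Y (ofA B a) (-1) (ofA B a') = ofA B (a * a') :=
  (Y_ofProd_toVB (a, 0) (-1) _).trans (toVB_eq_of_EGen (.mul a a'))

theorem Y_ofA_ofB (a : A) (b : B) :
    VertexAlgebra.Y (ofA B a) (-1) (ofB A b) = ofB A (star a b) :=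
  (Y_ofProd_toVB (a, 0) (-1) _).trans (toVB_eq_of_EGen (.star a b))

theorem ofB_d (a : A) :
    ofB A (d a : B) = VertexAlgebra.Y (ofA B a) (-2) (VertexAlgebra.vac : VB A B) := by
  refine Eq.trans ?_ (Y_ofProd_toVB (a, 0) (-2) (VL.vac A B)).symm
  rw [ofB, VL.g_d, neg_one_smul, neg_neg]
  rfl

theorem ofA_mem_weight (a : A) : ofA B a ∈ VB.weight A B 0 :=
  Submodule.mem_map_of_mem (Submodule.subset_span
    (by simpa using VL.Monomial.ofA (B := B) a (-1) 0 _ .vac))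

theorem ofB_mem_weight (b : B) : ofB A b ∈ VB.weight A B 1 :=
  Submodule.mem_map_of_mem (Submodule.subset_span
    (by simpa using VL.Monomial.ofB (A := A) b (-1) 0 _ .vac))

end Generators

section Modes

variable {A B M : Type*} [CommRing A] [Algebra ℂ A] [AddCommGroup B] [Module ℂ B]
  [VertexAlgebroid A B] [AddCommGroup M] [Module ℂ M] [VertexModule (VB A B) M]

theorem commutator_ofProd (u v : A × B) (m n : ℤ) (w : M) :
    Y (ofProd A B u) m (Y (ofProd A B v) n w) - Y (ofProd A B v) n (Y (ofProd A B u) m w) =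
      Y (ofProd A B (op0 A B u v)) (m + n) w +
        m • Y (ofProd A B (op1 A B u v)) (m + n - 1) w := by
  rw [commutator_formula, bsum_eq_range m 2 fun i hi => by
    rw [Y_ofProd_of_two_le u v (by omega), map_zero, Pi.zero_apply, LinearMap.zero_apply]]
  simp [Finset.sum_range_succ, Y_ofProd_zero, Y_ofProd_one]

theorem commutator_ofB_ofB (b b' : B) (w : M) :
    Y (ofB A b) 0 (Y (ofB A b') 0 w) - Y (ofB A b') 0 (Y (ofB A b) 0 w) =
      Y (ofB A (bracket A b b')) 0 w := by
  have h := commutator_ofProd ((0, b) : A × B) (0, b') 0 0 w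
  simp only [op0_apply, map_zero, sub_zero, zero_smul, add_zero] at h
  exact h

theorem commutator_ofB_ofA (b : B) (a : A) (w : M) :
    Y (ofB A b) 0 (Y (ofA B a) (-1) w) - Y (ofA B a) (-1) (Y (ofB A b) 0 w) =
      Y (ofA B (π b a)) (-1) w := by
  have h := commutator_ofProd ((0, b) : A × B) (a, 0) 0 (-1) w
  simp only [op0_apply, map_zero, sub_zero, zero_smul, add_zero, zero_add] at h
  exact h

theorem Y_ofB_d_zero (a : A) (w : M) : Y (ofB A (d a : B)) 0 w = 0 := by
  rw [ofB_d, Y_translate_zero]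

theorem Y_mem_of_ofProd_mem {Q : Submodule ℂ M}
    (hQ : ∀ u n, ∀ x ∈ Q, Y (ofProd A B u) n x ∈ Q) (v : VB A B) (n : ℤ) {x : M} (hx : x ∈ Q) :
    Y v n x ∈ Q := by
  have htop : modeStabilizer (VB A B) Q = ⊤ :=
    VB.eq_top_of_stable (vac_mem_modeStabilizer Q) fun u l _ hv => Y_mem_modeStabilizer (hQ u) hv l
  have hv : v ∈ modeStabilizer (VB A B) Q := htop ▸ Submodule.mem_top
  exact hv n x hx

variable (A B M) in
/-- The operators `a_n` with `n ≤ -2` and `b_n` with `n ≤ -1`: those modes of `A` and `B` which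
raise degrees. -/
def raisingModes : Set (Module.End ℂ M) :=
  {t | ∃ (a : A) (n : ℤ), n ≤ -2 ∧ Y (ofA B a) n = t} ∪
    {t | ∃ (b : B) (n : ℤ), n ≤ -1 ∧ Y (ofB A b) n = t}

theorem commutator_raisingModes_mem_span (u : A × B) (m : ℤ) {t : Module.End ℂ M}
    (ht : t ∈ raisingModes A B M) :
    Y (ofProd A B u) m * t - t * Y (ofProd A B u) m ∈
      Submodule.span ℂ (Set.range fun p : (A × B) × ℤ => Y (W := M) (ofProd A B p.1) p.2) := by
  obtain ⟨v, n, rfl⟩ : ∃ v n, Y (ofProd A B v) n = t := by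
    rcases ht with ⟨a, n, -, rfl⟩ | ⟨b, n, -, rfl⟩
    exacts [⟨(a, 0), n, rfl⟩, ⟨(0, b), n, rfl⟩]
  rw [show Y (ofProd A B u) m * Y (ofProd A B v) n - Y (ofProd A B v) n * Y (ofProd A B u) m =
      Y (W := M) (ofProd A B (op0 A B u v)) (m + n) +
        m • Y (ofProd A B (op1 A B u v)) (m + n - 1) from
    LinearMap.ext fun w => commutator_ofProd u v m n w]
  exact add_mem (Submodule.subset_span (Set.mem_range_self (op0 A B u v, m + n)))
    (zsmul_mem (Submodule.subset_span (Set.mem_range_self (op1 A B u v, m + n - 1))) m)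

end Modes

section VacuumSubspace

variable (A B : Type*) {M : Type*} [CommRing A] [Algebra ℂ A] [AddCommGroup B] [Module ℂ B]
  [VertexAlgebroid A B] [AddCommGroup M] [Module ℂ M] [VertexModule (VB A B) M]

/-- A subspace of a `V_B`-module that behaves like the lowest component of a grading: it is killed
by the modes of `A` and `B` which lower degrees and stable under those which preserve degrees. -/
structure IsVacuumSubspace (P : Submodule ℂ M) : Prop where
  ofA_eq_zero : ∀ (a : A) (n : ℤ), 0 ≤ n → ∀ w ∈ P, Y (ofA B a) n w = 0
  ofB_eq_zero : ∀ (b : B) (n : ℤ), 0 < n → ∀ w ∈ P, Y (ofB A b) n w = 0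
  ofA_mem : ∀ a : A, ∀ w ∈ P, Y (ofA B a) (-1) w ∈ P
  ofB_mem : ∀ b : B, ∀ w ∈ P, Y (ofB A b) 0 w ∈ P

namespace IsVacuumSubspace

variable {A B} {P : Submodule ℂ M}

theorem Y_ofA_mul (hP : IsVacuumSubspace A B P) (a a' : A) {w : M} (hw : w ∈ P) :
    Y (ofA B (a * a')) (-1) w = Y (ofA B a) (-1) (Y (ofA B a') (-1) w) := by
  rw [← Y_ofA_ofA]
  exact Y_neg_one_apply_of_eq_zero (fun i hi => hP.ofA_eq_zero a i hi w hw)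
    fun i hi => hP.ofA_eq_zero a' i (by omega) w hw

theorem Y_ofB_star (hP : IsVacuumSubspace A B P) (a : A) (b : B) {w : M} (hw : w ∈ P) :
    Y (ofB A (star a b)) 0 w = Y (ofA B a) (-1) (Y (ofB A b) 0 w) := by
  rw [← Y_ofA_ofB]
  exact Y_neg_one_apply_of_eq_zero (fun i hi => hP.ofA_eq_zero a i hi w hw)
    fun i hi => hP.ofB_eq_zero b i hi w hw

/-- The action of the algebra `A` by `a ↦ a_{-1}`. -/
noncomputable def smulHom (hP : IsVacuumSubspace A B P) : A →ₐ[ℂ] Module.End ℂ P :=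
  AlgHom.ofLinearMap
    (restrictEnd (LinearMap.proj (-1) ∘ₗ Y ∘ₗ ofProd A B ∘ₗ LinearMap.inl ℂ A B) P hP.ofA_mem)
    (LinearMap.ext fun w => Subtype.ext <|
      (congrArg (fun v => Y v (-1) (w : M)) ofA_one).trans (vac_left (-1) _))
    (fun a a' => LinearMap.ext fun w => Subtype.ext (hP.Y_ofA_mul a a' w.2))

/-- The action of the quotient `B / A∂A` by `b ↦ b_0`. -/
noncomputable def actHom (hP : IsVacuumSubspace A B P) : LieAlgd A B →ₗ[ℂ] Module.End ℂ P :=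
  (AdA A B).liftQ
    (restrictEnd (LinearMap.proj 0 ∘ₗ Y ∘ₗ ofProd A B ∘ₗ LinearMap.inr ℂ A B) P hP.ofB_mem) <| by
    refine Submodule.span_le.mpr ?_
    rintro _ ⟨a, a', rfl⟩
    ext w
    calc Y (ofB A (star a (d a'))) 0 (w : M)
        = Y (ofA B a) (-1) (Y (ofB A (d a')) 0 (w : M)) := hP.Y_ofB_star a _ w.2
      _ = 0 := by rw [Y_ofB_d_zero, map_zero]

/-- The structure of a module for the Lie algebroid `B / A∂A` on a vacuum subspace. -/
noncomputable def lieAlgebroidModule (hP : IsVacuumSubspace A B P) :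
    LieAlgebroidModule A (LieAlgd A B) P where
  smul := hP.smulHom
  act := hP.actHom
  act_lie u v w := by
    obtain ⟨u, rfl⟩ := LieAlgd.mk_surjective A B u
    obtain ⟨v, rfl⟩ := LieAlgd.mk_surjective A B v
    exact Subtype.ext (commutator_ofB_ofB u v (w : M)).symm
  act_smul u a w := by
    obtain ⟨u, rfl⟩ := LieAlgd.mk_surjective A B u
    exact Subtype.ext (commutator_ofB_ofA u a (w : M))
  smul_act a u w := by
    obtain ⟨u, rfl⟩ := LieAlgd.mk_surjective A B u
    exact Subtype.ext (hP.Y_ofB_star a u w.2).symm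

theorem map_subtype (hP : IsVacuumSubspace A B P) {N : Submodule ℂ P}
    (hA : ∀ a, ∀ w ∈ N, hP.lieAlgebroidModule.smul a w ∈ N)
    (hL : ∀ u, ∀ w ∈ N, hP.lieAlgebroidModule.act u w ∈ N) :
    IsVacuumSubspace A B (N.map P.subtype) where
  ofA_eq_zero a n hn w hw := hP.ofA_eq_zero a n hn w (Submodule.map_subtype_le P N hw)
  ofB_eq_zero b n hn w hw := hP.ofB_eq_zero b n hn w (Submodule.map_subtype_le P N hw)
  ofA_mem := by
    rintro a _ ⟨w, hw, rfl⟩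
    exact ⟨_, hA a w hw, rfl⟩
  ofB_mem := by
    rintro b _ ⟨w, hw, rfl⟩
    exact ⟨_, hL (LieAlgd.mk A B b) w hw, rfl⟩

theorem Y_ofA_mem_stableClosure (hP : IsVacuumSubspace A B P) (a : A) (n : ℤ) {x : M}
    (hx : x ∈ P) : Y (ofA B a) n x ∈ stableClosure (raisingModes A B M) P := by
  rcases lt_trichotomy n (-1) with hn | rfl | hn
  · exact apply_mem_stableClosure (.inl ⟨a, n, by omega, rfl⟩) (le_stableClosure hx)
  · exact le_stableClosure (hP.ofA_mem a x hx)
  · rw [hP.ofA_eq_zero a n (by omega) x hx]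
    exact zero_mem _

theorem Y_ofB_mem_stableClosure (hP : IsVacuumSubspace A B P) (b : B) (n : ℤ) {x : M}
    (hx : x ∈ P) : Y (ofB A b) n x ∈ stableClosure (raisingModes A B M) P := by
  rcases lt_trichotomy n 0 with hn | rfl | hn
  · exact apply_mem_stableClosure (.inr ⟨b, n, by omega, rfl⟩) (le_stableClosure hx)
  · exact le_stableClosure (hP.ofB_mem b x hx)
  · rw [hP.ofB_eq_zero b n hn x hx]
    exact zero_mem _

theorem Y_mem_stableClosure (hP : IsVacuumSubspace A B P) (v : VB A B) (n : ℤ) {x : M}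
    (hx : x ∈ stableClosure (raisingModes A B M) P) :
    Y v n x ∈ stableClosure (raisingModes A B M) P := by
  refine Y_mem_of_ofProd_mem (fun u n x hx => ?_) v n hx
  refine apply_mem_stableClosure_of_commutator
    (F := Set.range fun p : (A × B) × ℤ => Y (ofProd A B p.1) p.2) ?_ ?_ ⟨(u, n), rfl⟩ hx
  · rintro _ ⟨p, rfl⟩ t ht
    exact commutator_raisingModes_mem_span p.1 p.2 ht
  · rintro _ ⟨p, rfl⟩ x hx
    change Y (ofProd A B p.1) p.2 x ∈ _
    rw [ofProd_eq, map_add, Pi.add_apply, LinearMap.add_apply]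
    exact add_mem (hP.Y_ofA_mem_stableClosure _ _ hx) (hP.Y_ofB_mem_stableClosure _ _ hx)

end IsVacuumSubspace

end VacuumSubspace

namespace IsNGraded

variable {A B M : Type*} [CommRing A] [Algebra ℂ A] [AddCommGroup B] [Module ℂ B]
  [VertexAlgebroid A B] [AddCommGroup M] [Module ℂ M] [VertexModule (VB A B) M]
  {W : ℕ → Submodule ℂ M}

theorem isVacuumSubspace (hW : IsNGraded A B W) : IsVacuumSubspace A B (W 0) where
  ofA_eq_zero a n hn w hw := hW.mode_eq_zero 0 n 0 _ (ofA_mem_weight a) w hw (by omega)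
  ofB_eq_zero b n hn w hw := hW.mode_eq_zero 1 n 0 _ (ofB_mem_weight b) w hw (by omega)
  ofA_mem a w hw := hW.mode_mem 0 (-1) 0 0 _ (ofA_mem_weight a) w hw (by omega)
  ofB_mem b w hw := hW.mode_mem 1 0 0 0 _ (ofB_mem_weight b) w hw (by omega)

theorem exists_ne_zero_raisingModes_mem (hW : IsNGraded A B W) {t : Module.End ℂ M}
    (ht : t ∈ raisingModes A B M) (k : ℕ) : ∃ j ≠ 0, ∀ w ∈ W k, t w ∈ W j := by
  rcases ht with ⟨a, n, hn, rfl⟩ | ⟨b, n, hn, rfl⟩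
  · exact ⟨(k - n - 1).toNat, by omega, fun w hw =>
      hW.mode_mem 0 n k _ _ (ofA_mem_weight a) w hw (by omega)⟩
  · exact ⟨(k - n).toNat, by omega, fun w hw =>
      hW.mode_mem 1 n k _ _ (ofB_mem_weight b) w hw (by omega)⟩

theorem eq_bot_or_eq_of_isGradedSimple (hW : IsNGraded A B W) (hs : IsGradedSimple A B W)
    {N : Submodule ℂ M} (hN : IsVacuumSubspace A B N) (hN0 : N ≤ W 0) : N = ⊥ ∨ N = W 0 := by
  let C := stableClosure (raisingModes A B M) N
  have hraise := fun t (ht : t ∈ raisingModes A B M) => hW.exists_ne_zero_raisingModes_mem ht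
  have hgraded : C = ⨆ n, C ⊓ W n :=
    stableClosure_eq_iSup_inf (fun t ht k => (hraise t ht k).imp fun _ h => h.2) hN0
  have hzero : C ⊓ W 0 = N := stableClosure_inf_eq hW.isInternal.submodule_iSupIndep
    hW.isInternal.submodule_iSup_eq_top hraise hN0
  refine (hs.2 C (fun v n x => hN.Y_mem_stableClosure v n) hgraded).imp (fun hC => ?_) fun hC => ?_
  · rw [← hzero, hC, bot_inf_eq]
  · rw [← hzero, hC, top_inf_eq]

theorem isSimple_lieAlgebroidModule (hW : IsNGraded A B W) (hW0 : W 0 ≠ ⊥)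
    (hs : IsGradedSimple A B W) : hW.isVacuumSubspace.lieAlgebroidModule.IsSimple := by
  refine ⟨Submodule.nontrivial_iff_ne_bot.mpr hW0, fun N hA hL => ?_⟩
  refine (hW.eq_bot_or_eq_of_isGradedSimple hs (hW.isVacuumSubspace.map_subtype hA hL)
    (Submodule.map_subtype_le _ _)).imp (fun h => ?_) fun h => ?_
  · exact Submodule.map_injective_of_injective (W 0).injective_subtype
      (h.trans (Submodule.map_bot _).symm)
  · exact Submodule.map_injective_of_injective (W 0).injective_subtype
      (h.trans (Submodule.map_subtype_top _).symm)

end IsNGraded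

end VertexAlgebroid

theorem proposition4p8 {A B M : Type*} [CommRing A] [Algebra ℂ A] [AddCommGroup B] [Module ℂ B]
    [VertexAlgebroid A B] [AddCommGroup M] [Module ℂ M] [VertexModule (VertexAlgebroid.VB A B) M]
    (W : ℕ → Submodule ℂ M) (hW : VertexAlgebroid.IsNGraded A B W) (hW0 : W 0 ≠ ⊥) :
    ∃ 𝓜 : LieAlgebroidModule A (VertexAlgebroid.LieAlgd A B) (W 0),
      (∀ (a : A) (w : W 0),
        (𝓜.smul a w : M) = VertexModule.Y (VertexAlgebroid.ofA B a) (-1) (w : M)) ∧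
      (∀ (b : B) (w : W 0),
        (𝓜.act (VertexAlgebroid.LieAlgd.mk A B b) w : M) =
          VertexModule.Y (VertexAlgebroid.ofB A b) 0 (w : M)) ∧
      (VertexAlgebroid.IsGradedSimple A B W → 𝓜.IsSimple) :=
  ⟨hW.isVacuumSubspace.lieAlgebroidModule, fun _ _ => rfl, fun _ _ => rfl,
    hW.isSimple_lieAlgebroidModule hW0⟩
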